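/- Let $\mathbb F_q$ be a finite field of characteristic $p$. For $n\ge 1$ identify $c\in\mathbb F_q^n$ with $c_0+c_1x+\dots+c_{n-1}x^{n-1}\in\mathbb F_q[x]/\langle x^n-1\rangle$, and for $n=p^s$, $s\ge 1$, let $C_i=\langle (x-1)^i\rangle\subseteq\mathbb F_q[x]/\langle x^{p^s}-1\rangle$. For integers $r,\delta\ge 1$, a linear code $C\subseteq\mathbb F_q^n$ has locality $(r,\delta)$ if every coordinate lies in a set $T$ of at most $r+\delta-1$ coordinates such that the code $C|_T$ (the restriction of all codewords to $T$) has minimum distance at least $\delta$. It is an optimal $(r,\delta)$-LRC if it has locality $(r,\delta)$ and its dimension $k$ and minimum distance $d$ attain the Singleton-type bound with equality, $$d=n-k+1-\left(\left\lceil \tfrac kr\right\rceil-1\right)(\delta-1).$$ Write $[n,k,d;r,\delta]$ for the parameters of such a code. (1) The following codes are optimal $(r,\delta)$-LRCs with the stated parameters: - (B.1) $C_{p^s-p+\tau}$: $[p^s,\,p-\tau,\,(\tau+1)p^{s-1};\,1,\,p^{s-1}]$, for $1\le\tau\le p-1$, $s>1$; - (B.2) $C_{p^s-p^{s-t-1}}$: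 $[p^s,\,p^{s-t-1},\,p^{t+1};\,1,\,p^{t+1}]$, for $0\le t\le s-1$; - (B.3) $C_\tau$ (with $s=1$): $[p,\,p-\tau,\,\tau+1;\,p-\tau,\,\delta]$, for $1\le\tau\le p-2$, $2\le\delta\le\tau+1$; - (B.4) $C_{\tau p^{s-1}}$: $[p^s,\,(p-\tau)p^{s-1},\,\tau+1;\,p-\tau,\,\tau+1]$, for $1\le\tau\le p-2$, $s\ge1$; - (B.5) $C_{p^s-p^{s-t}+1}$: $[p^s,\,p^{s-t}-1,\,2p^t;\,1,\,p^t]$, for $0\le t\le s-2$; - (B.6) $C_{(\tau-1)p^{s-1}+1}$: $[p^s,\,(p-\tau+1)p^{s-1}-1,\,\tau+1;\,p-\tau+1,\,\tau]$, for $2\le\tau\le p-1$, $s\ge1$. (2) Let $s\ge 1$, $0\le t\le s-1$, $1\le\tau\le p-1$ and $$p^s-p^{s-t}+(\tau-1)p^{s-t-1}<i\le p^s-p^{s-t}+\tau p^{s-t-1}.$$ Let $r\ge1$ and $\delta\ge2$, and assume moreover $\delta\le\tau p^t$ if $i\ne p^s-p^{s-t}+\tau p^{s-t-1}$. Then $C_i$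 is an optimal $(r,\delta)$-LRC if and only if $(C_i;r,\delta)$ is one of the codes (B.1)–(B.6) with the pair $(r,\delta)$ given there, or one of the following trivial cases holds: $i=p^s-1$ (so $k=1$) and $\delta\le p^s$; or $s=1$, $r>p-i=k$ and $\delta\le i+1=d$. (3) For fixed $\mathbb F_q$, the families other than (B.3) have unbounded length: for every $N$ and every admissible $\tau$ in (B.1), (B.4), (B.6), and for every $t\ge0$ in (B.2), (B.5), there is an admissible $s$ with $p^s>N$ for which the code of the family is an optimal $(r,\delta)$-LRC with the parameters in (1). (For $p=2$ there is no admissible $\tau$ in (B.3), (B.4), (B.6).) -/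

import Mathlib

open Polynomial

noncomputable section

/-- The minimum distance of a linear code whose coordinates are indexed by `ι`: the least Hamming
weight of a nonzero codeword (`0` for the zero code). -/
def minDist {F ι : Type*} [Field F] [DecidableEq F] [Fintype ι] (C : Submodule F (ι → F)) : ℕ :=
  sInf {w : ℕ | ∃ c ∈ C, c ≠ 0 ∧ hammingNorm c = w}

/-- The punctured code `C|_T`: every codeword is restricted to the coordinates in `T`. -/
def puncture {F : Type*} [Field F] {n : ℕ} (C : Submodule F (Fin n → F)) (T : Finset (Fin n)) :
    Submodule F (T → F) :=
  C.map (LinearMap.funLeft F F (fun j : T => (j : Fin n)))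

/-- All-symbol `(r, δ)`-locality: every coordinate `i` lies in a set `T` of at most `r + δ - 1`
coordinates such that the punctured code `C|_T` has minimum distance at least `δ`. -/
def HasLocality {F : Type*} [Field F] [DecidableEq F] {n : ℕ} (C : Submodule F (Fin n → F))
    (r δ : ℕ) : Prop :=
  1 ≤ r ∧ 1 ≤ δ ∧
    ∀ i : Fin n, ∃ T : Finset (Fin n), i ∈ T ∧ T.card ≤ r + δ - 1 ∧ δ ≤ minDist (puncture C T)

/-- `C` is an optimal `(r, δ)`-LRC: it has `(r, δ)`-locality and attains the Singleton-type bound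
`d ≤ n - k + 1 - (⌈k / r⌉ - 1) (δ - 1)` with equality. -/
def IsOptimalLRC {F : Type*} [Field F] [DecidableEq F] {n : ℕ} (C : Submodule F (Fin n → F))
    (r δ : ℕ) : Prop :=
  HasLocality C r δ ∧
    (minDist C : ℤ) = (n : ℤ) - Module.finrank F C + 1
      - (⌈(Module.finrank F C : ℚ) / (r : ℚ)⌉ - 1) * ((δ : ℤ) - 1)

/-- `C` is an optimal `(r, δ)`-LRC with parameters `[n, k, d; r, δ]`. -/
def IsOptimalWithParams {F : Type*} [Field F] [DecidableEq F] {n : ℕ}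
    (C : Submodule F (Fin n → F)) (k d r δ : ℕ) : Prop :=
  Module.finrank F C = k ∧ minDist C = d ∧ IsOptimalLRC C r δ

/-- The polynomial representation `c ↦ c₀ + c₁ x + ⋯ + c_{n-1} x^{n-1}` in `F[x] / ⟨x^n - 1⟩`. -/
def polyRep (F : Type*) [Field F] (n : ℕ) :
    (Fin n → F) →ₗ[F] (F[X] ⧸ Ideal.span {(X ^ n - 1 : F[X])}) :=
  ∑ j : Fin n, (LinearMap.proj j).smulRight
    (Ideal.Quotient.mk (Ideal.span {(X ^ n - 1 : F[X])}) (X ^ (j : ℕ)))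

/-- The cyclic code `C_i` of length `n` over `F`: the vectors whose polynomial representation lies
in the ideal `⟨(x - 1)^i⟩` of `F[x] / ⟨x^n - 1⟩`. -/
def rootCode (F : Type*) [Field F] (n i : ℕ) : Submodule F (Fin n → F) :=
  ((Ideal.span {Ideal.Quotient.mk (Ideal.span {(X ^ n - 1 : F[X])}) ((X - 1) ^ i)}).restrictScalars
    F).comap (polyRep F n)

/-- `C_i`, of length `p ^ s`, together with `(r, δ)`, belongs to one of the six families
B.1, ..., B.6 (in this order). -/
def InFamilies (p s i r δ : ℕ) : Prop :=
  (1 < s ∧ ∃ τ, 1 ≤ τ ∧ τ ≤ p - 1 ∧ i = p ^ s - p + τ ∧ r = 1 ∧ δ = p ^ (s - 1)) ∨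
  (∃ t, t < s ∧ i = p ^ s - p ^ (s - t - 1) ∧ r = 1 ∧ δ = p ^ (t + 1)) ∨
  (s = 1 ∧ ∃ τ, 1 ≤ τ ∧ τ ≤ p - 2 ∧ i = τ ∧ r = p - τ ∧ 2 ≤ δ ∧ δ ≤ τ + 1) ∨
  (∃ τ, 1 ≤ τ ∧ τ ≤ p - 2 ∧ i = τ * p ^ (s - 1) ∧ r = p - τ ∧ δ = τ + 1) ∨
  (∃ t, t + 2 ≤ s ∧ i = p ^ s - p ^ (s - t) + 1 ∧ r = 1 ∧ δ = p ^ t) ∨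
  (∃ τ, 2 ≤ τ ∧ τ ≤ p - 1 ∧ i = (τ - 1) * p ^ (s - 1) + 1 ∧ r = p - τ + 1 ∧ δ = τ)

end

/-!
A word of length `n = p ^ s` is read as a polynomial `f` of degree less than `n`; it lies in `C_i`
if and only if `(X - 1) ^ i` divides `f` (`mem_rootCode_iff`), so `C_i` has dimension `n - i`
(`finrank_rootCode`). Put `P = p ^ t`, `u = p ^ (s - t - 1)`, `n' = p * u` and `i = n - n' + j` with
`(τ - 1) * u < j ≤ τ * u`. Since `(X - 1) ^ (n - n') = 1 + X ^ n' + ⋯ + X ^ (n' * (P - 1))`, the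
code `C_i` is the `P`-fold repetition of the code of length `n'` of the multiples of `(X - 1) ^ j`.

*Minimum distance.* Since `(X - 1) ^ u = X ^ u - 1`, divisibility by `(X - 1) ^ (a * u)` is
inherited in the form `(Y - 1) ^ a`, `Y = X ^ u`, by each residue class of exponents modulo `u`. A
nonzero polynomial in `Y` of degree less than `p` divisible by `(Y - 1) ^ a` has more than `a` terms,
because `Y d/dY - e` removes one term and at most one root. This gives `d = (τ + 1) * P`
(`minDist_rootCode`), as well as the recovering sets of the optimal codes: the residue classes
modulo `n'` (`hasLocality_one_of_le`) and modulo `u` (`hasLocality_of_mul_le`), and arbitrary sets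
for the MDS codes (`HasLocality.of_le_minDist`).

*Classification.* In the code of length `n'` any `p - τ` positions are independent, and even any
`p - τ + 1` if `j < τ * u` (`exists_interpolation`). Hence a recovering set with `δ > P` forces
`r ≥ p - τ`, respectively `r ≥ p - τ + 1` (`HasLocality.bounds`). Also `δ ≤ d`, and
`δ ≤ τ * P` is assumed if `j < τ * u`. With `q = ⌈k / r⌉ - 1`, equality in the Singleton-type bound says
`q * (δ - 1) = (n' - τ - 1) * (P - 1) + j - τ`, while the constraints make the left side at most the
right side, with equality only for the listed and the trivial codes
(`eq_cases_of_singleton_eq`).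
-/

open Polynomial

noncomputable section

/-! ### Weights of polynomials divisible by a power of `X - 1` -/

section Weight

variable {F : Type*} [Field F]

/-- The operator `X d/dX - a`, which multiplies the coefficient of `X ^ e` by `e - a`. It lowers
the multiplicity of a root by at most one. -/
def eulerShift (a : F) (f : F[X]) : F[X] := X * derivative f - C a * f

theorem coeff_eulerShift (a : F) (f : F[X]) (e : ℕ) :
    (eulerShift a f).coeff e = ((e : F) - a) * f.coeff e := by
  unfold eulerShift
  rw [coeff_sub, coeff_C_mul]
  cases e with
  | zero => simp
  | succ e => rw [coeff_X_mul, coeff_derivative]; push_cast; ring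

theorem pow_dvd_eulerShift {a : F} {f g : F[X]} {m : ℕ} (h : g ^ (m + 1) ∣ f) :
    g ^ m ∣ eulerShift a f :=
  dvd_sub ((pow_sub_one_dvd_derivative_of_pow_dvd h).mul_left _)
    (((pow_dvd_pow g m.le_succ).trans h).mul_left _)

/-- A nonzero polynomial divisible by `(X - 1) ^ a` has at least `a + 1` terms, provided its
exponents are distinct in `F`: the operator `X d/dX - e` with `e` an exponent removes exactly one
term and at most one factor `X - 1`. -/
theorem succ_le_card_support_of_injOn (a : ℕ) (f : F[X]) (hf : f ≠ 0)
    (hinj : Set.InjOn (Nat.cast : ℕ → F) f.support) (h : (X - 1) ^ a ∣ f) :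
    a + 1 ≤ f.support.card := by
  induction a generalizing f with
  | zero => simpa [Finset.one_le_card] using hf
  | succ a ih =>
    obtain ⟨e, he⟩ := Finset.nonempty_iff_ne_empty.2 (mt support_eq_empty.1 hf)
    have hsupp : (eulerShift (e : F) f).support = f.support.erase e := by
      ext d
      rw [mem_support_iff, coeff_eulerShift, Finset.mem_erase, mul_ne_zero_iff, sub_ne_zero,
        ← mem_support_iff]
      constructor
      · rintro ⟨h1, h2⟩
        exact ⟨fun h => h1 (by rw [h]), h2⟩
      · rintro ⟨h1, h2⟩
        exact ⟨fun h => h1 (hinj h2 he h), h2⟩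
    have hne : eulerShift (e : F) f ≠ 0 := by
      intro h0
      -- otherwise `f` is a monomial, which does not vanish at `1`
      have h1 : f.support ⊆ {e} := by
        rw [h0, support_zero] at hsupp
        exact (Finset.erase_eq_empty_iff _ _).1 hsupp.symm |>.elim (fun h => by simp [h])
          (fun h => by simp [h])
      obtain ⟨q, hq⟩ := (dvd_pow_self (X - 1 : F[X]) a.succ_ne_zero).trans h
      have h2 : f.eval 1 = 0 := by simp [hq]
      rw [eval_eq_sum, sum_def, Finset.sum_subset h1 (by simp +contextual)] at h2
      exact (mem_support_iff.1 he) (by simpa using h2)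
    have := ih _ hne (by rw [hsupp]; exact hinj.mono (by simp))
      (pow_dvd_eulerShift h)
    rw [hsupp, Finset.card_erase_of_mem he] at this
    have := Finset.card_pos.2 ⟨e, he⟩
    omega

/-- The terms of `f` whose exponents are congruent to `b` modulo `u`, read as a polynomial in
`X ^ u`. The exponent `b + l * u` becomes `l + 1`. -/
def classSection (u b : ℕ) (f : F[X]) : F[X] := contract u (X ^ (u - b) * f)

theorem coeff_classSection {u b : ℕ} (hb : b < u) (f : F[X]) (l : ℕ) :
    (classSection u b f).coeff l = if l = 0 then 0 else f.coeff (b + (l - 1) * u) := by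
  rw [classSection, coeff_contract (by omega), coeff_X_pow_mul']
  cases l with
  | zero => simp; omega
  | succ l =>
    have : (l + 1) * u - (u - b) = b + l * u := by rw [add_mul]; omega
    rw [if_pos (by rw [add_mul]; omega), this]
    simp

theorem coeff_classSection_succ {u b : ℕ} (hb : b < u) (f : F[X]) (l : ℕ) :
    (classSection u b f).coeff (l + 1) = f.coeff (b + l * u) := by
  simp [coeff_classSection hb]

theorem classSection_ne_zero {u b e : ℕ} (hb : b < u) {f : F[X]} (he : f.coeff e ≠ 0)
    (heb : e % u = b) : classSection u b f ≠ 0 := by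
  intro h
  have := coeff_classSection_succ hb f (e / u)
  rw [h, ← heb, mul_comm, Nat.mod_add_div] at this
  exact he (by simpa using this.symm)

theorem support_classSection_subset {u b : ℕ} (hb : b < u) (f : F[X]) :
    (classSection u b f).support ⊆
      (f.support.filter (fun e => e % u = b)).image (fun e => e / u + 1) := by
  intro l hl
  rw [mem_support_iff, coeff_classSection hb] at hl
  have hl0 : l ≠ 0 := fun h => by simp [h] at hl
  rw [if_neg hl0] at hl
  refine Finset.mem_image.2 ⟨b + (l - 1) * u, ?_, ?_⟩
  · simp [hl, Nat.mod_eq_of_lt hb]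
  · rw [Nat.add_mul_div_right _ _ (by omega), Nat.div_eq_of_lt hb]
    omega

theorem card_support_classSection_le {u b : ℕ} (hb : b < u) (f : F[X]) :
    (classSection u b f).support.card ≤ (f.support.filter (fun e => e % u = b)).card :=
  (Finset.card_le_card (support_classSection_subset hb f)).trans Finset.card_image_le

theorem pow_dvd_classSection {u a b : ℕ} (hb : b < u) {f : F[X]} (h : (X ^ u - 1) ^ a ∣ f) :
    (X - 1) ^ a ∣ classSection u b f := by
  obtain ⟨g, rfl⟩ := h
  have : X ^ (u - b) * ((X ^ u - 1) ^ a * g) = X ^ (u - b) * g * expand F u ((X - 1) ^ a) := by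
    simp only [map_pow, map_sub, expand_X, map_one]; ring
  rw [classSection, this, contract_mul_expand (by omega)]
  exact dvd_mul_left _ _

variable {p : ℕ} [CharP F p]

theorem injOn_natCast_support_classSection {u b : ℕ} (hb : b < u) {f : F[X]}
    (hf : ∀ e ∈ f.support, e < p * u) :
    Set.InjOn (Nat.cast : ℕ → F) (classSection u b f).support := by
  have key : ∀ l ∈ (classSection u b f).support, ∃ m, m < p ∧ l = m + 1 := by
    intro l hl
    obtain ⟨e, he, rfl⟩ := Finset.mem_image.1 (support_classSection_subset hb f hl)
    refine ⟨e / u, ?_, rfl⟩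
    rw [Nat.div_lt_iff_lt_mul (by omega)]
    exact hf e (Finset.mem_filter.1 he).1
  intro l hl l' hl' h
  obtain ⟨m, hm, rfl⟩ := key l hl
  obtain ⟨m', hm', rfl⟩ := key l' hl'
  push_cast at h
  rw [CharP.natCast_injOn_Iio F p hm hm' (add_right_cancel h)]

/-- Each residue class modulo `u` which meets the support of `f` meets it in more than `a`
exponents. -/
theorem succ_le_card_filter_support {u a e : ℕ} (hu : 0 < u) {f : F[X]}
    (hf : ∀ e ∈ f.support, e < p * u) (h : (X ^ u - 1) ^ a ∣ f) (he : f.coeff e ≠ 0) :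
    a + 1 ≤ (f.support.filter (fun d => d % u = e % u)).card :=
  (succ_le_card_support_of_injOn a _ (classSection_ne_zero (Nat.mod_lt e hu) he rfl)
    (injOn_natCast_support_classSection (Nat.mod_lt e hu) hf)
    (pow_dvd_classSection (Nat.mod_lt e hu) h)).trans
    (card_support_classSection_le (Nat.mod_lt e hu) f)

/-- A nonzero polynomial of degree less than `p * u` divisible by `(X ^ u - 1) ^ a * (X - 1)` has
at least `a + 2` terms. If the exponents meet two classes modulo `u`, there are even `2 * (a + 1)`
terms; if they lie in one class, the extra root `1` passes to the section. -/
theorem add_two_le_card_support {u a : ℕ} (hu : 0 < u) {f : F[X]} (hf0 : f ≠ 0)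
    (hf : ∀ e ∈ f.support, e < p * u) (h : (X ^ u - 1) ^ a * (X - 1) ∣ f) :
    a + 2 ≤ f.support.card := by
  obtain ⟨e, he⟩ := Finset.nonempty_iff_ne_empty.2 (mt support_eq_empty.1 hf0)
  have hb := Nat.mod_lt e hu
  have h' := (dvd_mul_right _ _).trans h
  have h1 := succ_le_card_filter_support hu hf h' (mem_support_iff.1 he)
  by_cases hcl : ∀ d ∈ f.support, d % u = e % u
  · set S := classSection u (e % u) f with hS
    have hexp : X ^ (u - e % u) * f = expand F u S := by
      ext d
      rw [coeff_expand hu]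
      split_ifs with hd
      · obtain ⟨l, rfl⟩ := hd
        rw [Nat.mul_div_cancel_left _ hu, hS, classSection, coeff_contract hu.ne', mul_comm l]
      · rw [coeff_X_pow_mul']
        split_ifs with h2
        · by_contra h3
          apply hd
          have h4 := hcl _ (mem_support_iff.2 h3)
          have h5 : d - (u - e % u) + (u - e % u) ≡ e + (u - e % u) [MOD u] :=
            Nat.ModEq.add_right _ h4
          have h6 := Nat.div_add_mod e u
          have h7 : e + (u - e % u) = u * (e / u + 1) := by rw [mul_add]; omega
          rw [Nat.sub_add_cancel h2, h7] at h5
          exact (Nat.modEq_zero_iff_dvd.1 (h5.trans (by simp [Nat.ModEq])))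
        · rfl
    obtain ⟨g, hg⟩ := pow_dvd_classSection hb h'
    rw [← hS] at hg
    have hX : (X ^ u - 1 : F[X]) ≠ 0 := by
      simpa using X_pow_sub_C_ne_zero (R := F) hu 1
    have h8 : (X ^ u - 1) ^ a * (X - 1) ∣ (X ^ u - 1) ^ a * expand F u g := by
      have : (X ^ u - 1) ^ a * expand F u g = X ^ (u - e % u) * f := by
        rw [hexp, hg]; simp
      rw [this]; exact h.mul_left _
    have h9 : (X - C 1 : F[X]) ∣ expand F u g := by
      simpa using (mul_dvd_mul_iff_left (pow_ne_zero a hX)).1 h8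
    rw [dvd_iff_isRoot, IsRoot, expand_eval, one_pow] at h9
    have h10 : (X - 1) ^ (a + 1) ∣ S := by
      rw [hg, pow_succ]
      exact mul_dvd_mul_left _ (by simpa using dvd_iff_isRoot.2 h9)
    have := succ_le_card_support_of_injOn _ S
      (classSection_ne_zero hb (mem_support_iff.1 he) rfl)
      (injOn_natCast_support_classSection hb hf) h10
    have : S.support.card ≤ _ := card_support_classSection_le hb f
    have := Finset.card_filter_le f.support (fun d => d % u = e % u)
    omega
  · push Not at hcl
    obtain ⟨d, hd, hde⟩ := hcl
    have h2 := succ_le_card_filter_support hu hf h' (mem_support_iff.1 hd)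
    have h3 : Disjoint (f.support.filter (fun c => c % u = e % u))
        (f.support.filter (fun c => c % u = d % u)) := by
      rw [Finset.disjoint_filter]
      intro c _ h4 h5
      exact hde (h5.symm.trans h4)
    have h4 := Finset.card_le_card (Finset.union_subset (Finset.filter_subset
      (fun c => c % u = e % u) f.support) (Finset.filter_subset (fun c => c % u = d % u) f.support))
    rw [Finset.card_union_of_disjoint h3] at h4
    omega

/-- The polynomial whose coefficients are the values `∏ l ∈ L, (e - l)` is divisible by
`(X - 1) ^ (p - 1 - #L)`. -/
theorem exists_pow_dvd_coeff_eq_prod [Fact p.Prime] (L : Finset ℕ) {a : ℕ}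
    (h : L.card + a < p) :
    ∃ f : F[X], (X - 1) ^ a ∣ f ∧
      ∀ e, f.coeff e = if e < p then ∏ l ∈ L, ((e : F) - l) else 0 := by
  induction L using Finset.induction generalizing a with
  | empty =>
    refine ⟨∑ i ∈ Finset.range p, X ^ i,
      (pow_dvd_pow _ (by simpa using Nat.le_sub_one_of_lt h)).trans
      (b := (X - 1) ^ (p - 1)) (dvd_of_eq ?_), fun e => by simp [coeff_X_pow]⟩
    have hX : (X - 1 : F[X]) ≠ 0 := by
      simpa using X_sub_C_ne_zero (1 : F)
    apply mul_left_cancel₀ hX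
    rw [mul_geom_sum, ← pow_succ', Nat.sub_add_cancel (Fact.out : p.Prime).one_le]
    simpa using sub_pow_char_pow (X : F[X]) 1 1 (p := p)
  | insert l L hl ih =>
    rw [Finset.card_insert_of_notMem hl] at h
    obtain ⟨f, h1, h2⟩ := ih (a := a + 1) (by omega)
    refine ⟨eulerShift l f, pow_dvd_eulerShift h1, fun e => ?_⟩
    rw [coeff_eulerShift, h2, Finset.prod_insert hl]
    split_ifs <;> simp

end Weight

/-! ### Repetition and explicit multiples of powers of `X - 1` -/

section Words

variable {F : Type*} [Field F]

theorem degree_X_sub_one_pow_mul_lt_iff {k m : ℕ} {g : F[X]} :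
    ((X - 1) ^ k * g).degree < ((k + m : ℕ) : WithBot ℕ) ↔ g.degree < m := by
  have hd : ((X - 1 : F[X]) ^ k).degree = k := by
    rw [← C_1, degree_pow, degree_X_sub_C]; simp
  rcases eq_or_ne g 0 with rfl | hg
  · simp
  · rw [degree_mul, hd, degree_eq_natDegree hg]
    norm_cast
    omega

theorem coeff_geom_sum_mul {n P e : ℕ} {g : F[X]} (hg : g.degree < n) (he : e < n * P) :
    ((∑ b ∈ Finset.range P, (X ^ n) ^ b) * g).coeff e = g.coeff (e % n) := by
  have hn : 0 < n := Nat.pos_of_ne_zero (by rintro rfl; simp at he)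
  rw [Finset.sum_mul, finsetSum_coeff, Finset.sum_eq_single (e / n)]
  · rw [← pow_mul, coeff_X_pow_mul', if_pos (Nat.mul_div_le e n)]
    congr 1
    have := Nat.div_add_mod e n
    omega
  · intro b _ hb
    rw [← pow_mul, coeff_X_pow_mul']
    split_ifs with h
    · refine (degree_lt_iff_coeff_zero _ _).1 hg _ ?_
      by_contra h1
      apply hb
      have h2 := Nat.div_add_mod e n
      symm
      rw [Nat.div_eq_iff hn]
      constructor
      · rw [mul_comm]; exact h
      · rw [mul_comm]; omega
    · rfl
  · intro h
    exact absurd (Finset.mem_range.2 ((Nat.div_lt_iff_lt_mul hn).2 (by rwa [mul_comm]))) h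

theorem mul_card_support_le_card_support_geom_sum_mul {n P : ℕ} {g : F[X]} (hg : g.degree < n) :
    P * g.support.card ≤ ((∑ b ∈ Finset.range P, (X ^ n) ^ b) * g).support.card := by
  have hlt : ∀ a ∈ g.support, a < n := fun a ha => by
    by_contra h
    exact mem_support_iff.1 ha ((degree_lt_iff_coeff_zero _ _).1 hg a (not_lt.1 h))
  rw [← Finset.card_range P, ← Finset.card_product, Finset.card_range]
  refine Finset.card_le_card_of_injOn (fun x => x.2 + n * x.1) ?_ ?_
  · rintro ⟨b, a⟩ h
    simp only [Finset.coe_product, Set.mem_prod, Finset.mem_coe, Finset.mem_range] at h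
    have ha := hlt a h.2
    have h1 : a + n * b < n * P := by nlinarith [h.1]
    simp only [Finset.mem_coe]
    rw [mem_support_iff, coeff_geom_sum_mul hg h1, Nat.add_mul_mod_self_left, Nat.mod_eq_of_lt ha]
    exact mem_support_iff.1 h.2
  · rintro ⟨b, a⟩ h ⟨b', a'⟩ h' heq
    simp only [Finset.coe_product, Set.mem_prod, Finset.mem_coe, Finset.mem_range] at h h'
    have ha := hlt a h.2
    have ha' := hlt a' h'.2
    dsimp only at heq
    have h1 := congrArg (· % n) heq
    simp only [Nat.add_mul_mod_self_left, Nat.mod_eq_of_lt ha, Nat.mod_eq_of_lt ha'] at h1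
    subst h1
    have h2 : b = b' := Nat.eq_of_mul_eq_mul_left (by omega : 0 < n) (by omega)
    rw [h2]

theorem coeff_X_pow_mul_expand {u b : ℕ} (hb : b < u) (f : F[X]) (e : ℕ) :
    (X ^ b * expand F u f).coeff e = if e % u = b then f.coeff (e / u) else 0 := by
  have h := Nat.div_add_mod e u
  rw [coeff_X_pow_mul']
  by_cases he : e % u = b
  · rw [if_pos he, if_pos (by omega), coeff_expand (by omega)]
    have : e - b = u * (e / u) := by omega
    rw [this, if_pos (dvd_mul_right _ _), Nat.mul_div_cancel_left _ (by omega)]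
  · rw [if_neg he]
    split_ifs with h1
    · rw [coeff_expand (by omega), if_neg]
      rintro ⟨l, hl⟩
      apply he
      rw [show e = b + u * l by omega, Nat.add_mul_mod_self_left, Nat.mod_eq_of_lt hb]
    · rfl

theorem coeff_geom_sum_mul_expand {u : ℕ} (hu : 0 < u) (f : F[X]) (e : ℕ) :
    ((∑ b ∈ Finset.range u, X ^ b) * expand F u f).coeff e = f.coeff (e / u) := by
  rw [Finset.sum_mul, finsetSum_coeff, Finset.sum_congr rfl fun b hb =>
    coeff_X_pow_mul_expand (Finset.mem_range.1 hb) f e]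
  simp [Nat.mod_lt e hu]

variable {p : ℕ} [Fact p.Prime] [CharP F p]

theorem X_sub_one_pow_prime_pow (m : ℕ) : (X - 1 : F[X]) ^ p ^ m = X ^ p ^ m - 1 := by
  simpa using sub_pow_char_pow (X : F[X]) 1 m (p := p)

theorem X_sub_one_pow_prime_pow_sub_one (m t : ℕ) :
    (X - 1 : F[X]) ^ (p ^ m * p ^ t - p ^ m) =
      ∑ b ∈ Finset.range (p ^ t), (X ^ p ^ m) ^ b := by
  have hX : (X - 1 : F[X]) ≠ 0 := by
    simpa using X_sub_C_ne_zero (1 : F)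
  have hp : 0 < p := (Fact.out : p.Prime).pos
  have hle : p ^ m ≤ p ^ m * p ^ t := Nat.le_mul_of_pos_right _ (pow_pos hp t)
  apply mul_left_cancel₀ (pow_ne_zero (p ^ m) hX)
  rw [← pow_add, Nat.add_sub_cancel' hle, X_sub_one_pow_prime_pow, mul_geom_sum, ← pow_add,
    X_sub_one_pow_prime_pow, pow_add, pow_mul]

theorem pow_mul_dvd_expand {m a : ℕ} {f : F[X]} (h : (X - 1) ^ a ∣ f) :
    (X - 1) ^ (a * p ^ m) ∣ expand F (p ^ m) f := by
  obtain ⟨g, rfl⟩ := h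
  rw [mul_comm, pow_mul, X_sub_one_pow_prime_pow]
  simp only [map_mul, map_pow, map_sub, expand_X, map_one]
  exact dvd_mul_right _ _

/-- A multiple of `(X - 1) ^ (n - n')`, where `n = p ^ m * p ^ t` and `n' = p ^ m`, is a
`p ^ t`-fold repetition of a word of length `n'`. -/
theorem exists_eq_geom_sum_mul {m t j : ℕ} {f : F[X]} (hf : f.degree < (p ^ m * p ^ t : ℕ))
    (h : (X - 1) ^ (p ^ m * p ^ t - p ^ m + j) ∣ f) :
    ∃ g : F[X], g.degree < (p ^ m : ℕ) ∧ (X - 1) ^ j ∣ g ∧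
      f = (∑ b ∈ Finset.range (p ^ t), (X ^ p ^ m) ^ b) * g := by
  obtain ⟨g, rfl⟩ := h
  have hle : p ^ m ≤ p ^ m * p ^ t :=
    Nat.le_mul_of_pos_right _ (pow_pos (Fact.out : p.Prime).pos t)
  refine ⟨(X - 1) ^ j * g, ?_, dvd_mul_right _ _, ?_⟩
  · rw [← degree_X_sub_one_pow_mul_lt_iff (k := p ^ m * p ^ t - p ^ m), ← mul_assoc, ← pow_add,
      Nat.sub_add_cancel hle]
    exact hf
  · rw [pow_add, X_sub_one_pow_prime_pow_sub_one, mul_assoc]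

/-- The lower bound for the minimum distance: a repetition multiplies the weight by `p ^ t`. -/
theorem mul_le_card_support {m t a j : ℕ} {f : F[X]} (hf0 : f ≠ 0)
    (hf : f.degree < (p ^ (m + 1) * p ^ t : ℕ)) (hj : a * p ^ m < j)
    (h : (X - 1) ^ (p ^ (m + 1) * p ^ t - p ^ (m + 1) + j) ∣ f) :
    (a + 2) * p ^ t ≤ f.support.card := by
  obtain ⟨g, hg, hdvd, rfl⟩ := exists_eq_geom_sum_mul hf h
  have hg0 : g ≠ 0 := fun h0 => hf0 (by simp [h0])
  have h2 : (X ^ p ^ m - 1) ^ a * (X - 1) ∣ g := by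
    refine dvd_trans ?_ hdvd
    rw [← X_sub_one_pow_prime_pow, ← pow_mul, ← pow_succ, mul_comm]
    exact pow_dvd_pow _ hj
  have h3 : a + 2 ≤ g.support.card := by
    refine add_two_le_card_support (p := p) (pow_pos (Fact.out : p.Prime).pos m) hg0
      (fun e he => ?_) h2
    by_contra h4
    rw [not_lt, mul_comm, ← pow_succ] at h4
    exact mem_support_iff.1 he ((degree_lt_iff_coeff_zero _ _).1 hg e h4)
  refine le_trans ?_ (mul_card_support_le_card_support_geom_sum_mul hg)
  rw [mul_comm]
  exact Nat.mul_le_mul_left _ h3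

/-- The power of `X - 1` which realizes the minimum distance. -/
theorem card_support_X_sub_one_pow_le (m t a : ℕ) :
    ((X - 1 : F[X]) ^ (p ^ (m + 1) * p ^ t - p ^ (m + 1) + a * p ^ m)).support.card
      ≤ (a + 1) * p ^ t := by
  have hle : p ^ (m + 1) ≤ p ^ (m + 1) * p ^ t :=
    Nat.le_mul_of_pos_right _ (pow_pos (Fact.out : p.Prime).pos t)
  have key : ∀ v b : ℕ, 0 < v → ((X ^ v - 1 : F[X]) ^ b).support.card ≤ b + 1 := by
    intro v b hv
    have h1 : (X ^ v - 1 : F[X]) ^ b = expand F v ((X - 1) ^ b) := by simp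
    have h2 : (expand F v ((X - 1) ^ b)).support ⊆ ((X - 1 : F[X]) ^ b).support.image (· * v) := by
      intro e he
      rw [mem_support_iff, coeff_expand hv] at he
      by_cases hd : v ∣ e
      · rw [if_pos hd] at he
        exact Finset.mem_image.2 ⟨e / v, mem_support_iff.2 he, Nat.div_mul_cancel hd⟩
      · simp [hd] at he
    have h3 : ((X - 1 : F[X]) ^ b).natDegree = b := by
      rw [← C_1, natDegree_pow, natDegree_X_sub_C, mul_one]
    rw [h1]
    refine (Finset.card_le_card h2).trans (Finset.card_image_le.trans ?_)
    exact (card_supp_le_succ_natDegree _).trans (by rw [h3])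
  have hp : 0 < p := (Fact.out : p.Prime).pos
  have h1 : p ^ (m + 1) * p ^ t - p ^ (m + 1) = p ^ (m + 1) * (p ^ t - 1) := by
    rw [Nat.mul_sub, mul_one]
  rw [pow_add, h1, pow_mul, mul_comm a, pow_mul, X_sub_one_pow_prime_pow, X_sub_one_pow_prime_pow]
  refine card_support_mul_le.trans ?_
  rw [mul_comm (a + 1)]
  refine Nat.mul_le_mul ((key _ _ (pow_pos hp _)).trans ?_) (key _ _ (pow_pos hp _))
  have := pow_pos hp t
  omega

/-- Interpolation in the code of multiples of `(X - 1) ^ j` of length `p * u`, `u = p ^ m`: any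
`p - τ` positions are independent if `j ≤ τ * u`, and any `p - τ + 1` are if `j < τ * u`. The
words are supported on one class modulo `u`, or constant on blocks of `u` consecutive positions,
and have polynomial functions as coefficients. -/
theorem exists_interpolation {m τ j j₀ : ℕ} (hτ : 1 ≤ τ) (S : Finset ℕ) (hj₀ : j₀ ∈ S)
    (hS : ∀ e ∈ S, e < p ^ (m + 1)) (hj : j ≤ τ * p ^ m)
    (hcard : S.card + τ ≤ p ∨ j < τ * p ^ m ∧ S.card + τ ≤ p + 1) :
    ∃ g : F[X], g.degree < (p ^ (m + 1) : ℕ) ∧ (X - 1) ^ j ∣ g ∧ g.coeff j₀ ≠ 0 ∧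
      ∀ e ∈ S, e ≠ j₀ → g.coeff e = 0 := by
  have hu : 0 < p ^ m := pow_pos (Fact.out : p.Prime).pos m
  have hlt : ∀ e, e < p ^ (m + 1) ↔ e / p ^ m < p := fun e => by
    rw [Nat.div_lt_iff_lt_mul hu, pow_succ, mul_comm]
  set A := (S.erase j₀).filter (fun e => e % p ^ m = j₀ % p ^ m) with hA
  set L := A.image (· / p ^ m) with hL
  have hLA : L.card ≤ A.card := Finset.card_image_le
  have hAS : A.card ≤ (S.erase j₀).card := Finset.card_filter_le _ _
  rw [Finset.card_erase_of_mem hj₀] at hAS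
  have hS1 : 1 ≤ S.card := Finset.card_pos.2 ⟨j₀, hj₀⟩
  have hzero : ∀ e ∈ A, ∏ l ∈ L, (((e / p ^ m : ℕ) : F) - l) = 0 := fun e he =>
    Finset.prod_eq_zero (Finset.mem_image_of_mem _ he) (sub_self _)
  have hne : ∏ l ∈ L, (((j₀ / p ^ m : ℕ) : F) - l) ≠ 0 := by
    refine Finset.prod_ne_zero_iff.2 fun l hl => ?_
    obtain ⟨e, he, rfl⟩ := Finset.mem_image.1 hl
    obtain ⟨he1, he2⟩ := Finset.mem_filter.1 he
    obtain ⟨he3, he4⟩ := Finset.mem_erase.1 he1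
    rw [sub_ne_zero]
    intro h
    have h1 := CharP.natCast_injOn_Iio F p ((hlt _).1 (hS _ hj₀)) ((hlt _).1 (hS _ he4)) h
    apply he3
    rw [← Nat.div_add_mod e (p ^ m), he2, ← h1, Nat.div_add_mod]
  by_cases hc : L.card + τ < p
  · obtain ⟨f, hf1, hf2⟩ := exists_pow_dvd_coeff_eq_prod (F := F) L hc
    refine ⟨X ^ (j₀ % p ^ m) * expand F (p ^ m) f, ?_, ?_, ?_, fun e he hej => ?_⟩
    · rw [degree_lt_iff_coeff_zero]
      intro e he
      have h0 : ¬e / p ^ m < p := by rw [← hlt]; omega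
      rw [coeff_X_pow_mul_expand (Nat.mod_lt _ hu), hf2, if_neg h0, ite_self]
    · exact ((pow_dvd_pow _ hj).trans (pow_mul_dvd_expand hf1)).mul_left _
    · rw [coeff_X_pow_mul_expand (Nat.mod_lt _ hu), if_pos rfl, hf2, if_pos ((hlt _).1 (hS _ hj₀))]
      exact hne
    · rw [coeff_X_pow_mul_expand (Nat.mod_lt _ hu)]
      split_ifs with hm
      · rw [hf2, if_pos ((hlt _).1 (hS _ he))]
        exact hzero e (Finset.mem_filter.2 ⟨Finset.mem_erase.2 ⟨hej, he⟩, hm⟩)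
      · rfl
  · -- here `S` lies in one class modulo `p ^ m`
    obtain ⟨hj', hcard'⟩ := hcard.resolve_left (by omega)
    have hAeq : A = S.erase j₀ := Finset.eq_of_subset_of_card_le (Finset.filter_subset _ _)
      (by rw [Finset.card_erase_of_mem hj₀]; omega)
    obtain ⟨f, hf1, hf2⟩ := exists_pow_dvd_coeff_eq_prod (F := F) (a := τ - 1) L (by omega)
    refine ⟨(∑ b ∈ Finset.range (p ^ m), X ^ b) * expand F (p ^ m) f, ?_, ?_, ?_,
      fun e he hej => ?_⟩
    · rw [degree_lt_iff_coeff_zero]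
      intro e he
      rw [coeff_geom_sum_mul_expand hu, hf2, if_neg]
      rw [← hlt]; omega
    · have h1 := X_sub_one_pow_prime_pow_sub_one (F := F) (p := p) 0 m
      rw [pow_zero, one_mul, pow_one] at h1
      rw [← h1]
      refine dvd_trans ?_ (mul_dvd_mul_left _ (pow_mul_dvd_expand hf1))
      rw [← pow_add]
      apply pow_dvd_pow
      obtain ⟨c, rfl⟩ : ∃ c, τ = c + 1 := ⟨τ - 1, by omega⟩
      rw [add_mul] at hj'
      simp only [Nat.add_sub_cancel]
      omega
    · rw [coeff_geom_sum_mul_expand hu, hf2, if_pos ((hlt _).1 (hS _ hj₀))]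
      exact hne
    · rw [coeff_geom_sum_mul_expand hu, hf2, if_pos ((hlt _).1 (hS _ he))]
      exact hzero e (by rw [hAeq]; exact Finset.mem_erase.2 ⟨hej, he⟩)

end Words

/-! ### Minimum distance and locality of linear codes -/

section Codes

variable {F : Type*} [Field F] [DecidableEq F]

theorem minDist_le {ι : Type*} [Fintype ι] {C : Submodule F (ι → F)} {c : ι → F} (hc : c ∈ C)
    (h0 : c ≠ 0) : minDist C ≤ hammingNorm c :=
  Nat.sInf_le ⟨c, hc, h0, rfl⟩

theorem le_minDist {ι : Type*} [Fintype ι] {C : Submodule F (ι → F)} {d : ℕ}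
    (hne : ∃ c ∈ C, c ≠ 0) (h : ∀ c ∈ C, c ≠ 0 → d ≤ hammingNorm c) : d ≤ minDist C := by
  obtain ⟨c, hc, h0⟩ := hne
  refine le_csInf ⟨_, c, hc, h0, rfl⟩ ?_
  rintro w ⟨c, hc, h0, rfl⟩
  exact h c hc h0

theorem hammingNorm_funLeft {n : ℕ} (T : Finset (Fin n)) (c : Fin n → F) :
    hammingNorm (LinearMap.funLeft F F (fun j : T => (j : Fin n)) c) =
      (T.filter (fun j => c j ≠ 0)).card := by
  rw [hammingNorm, ← Finset.card_map (Function.Embedding.subtype (· ∈ T))]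
  congr 1
  ext j
  simp only [LinearMap.funLeft_apply, Finset.mem_map, Finset.mem_filter,
    Function.Embedding.subtype_apply, Subtype.exists, exists_and_right, exists_eq_right]
  constructor
  · rintro ⟨h, h'⟩
    exact ⟨h, (Finset.mem_filter.1 h').2⟩
  · rintro ⟨h, h'⟩
    exact ⟨h, Finset.mem_filter.2 ⟨Finset.mem_univ _, h'⟩⟩

theorem minDist_puncture_le {n : ℕ} {C : Submodule F (Fin n → F)} {T : Finset (Fin n)}
    {c : Fin n → F} (hc : c ∈ C) {j : Fin n} (hj : j ∈ T) (h0 : c j ≠ 0) :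
    minDist (puncture C T) ≤ (T.filter (fun j => c j ≠ 0)).card := by
  rw [← hammingNorm_funLeft]
  refine minDist_le (Submodule.mem_map_of_mem hc) fun h => h0 ?_
  simpa using congrFun h ⟨j, hj⟩

theorem le_minDist_puncture {n : ℕ} {C : Submodule F (Fin n → F)} {T : Finset (Fin n)} {δ : ℕ}
    (hne : ∃ c ∈ C, ∃ j ∈ T, c j ≠ 0)
    (h : ∀ c ∈ C, ∀ j ∈ T, c j ≠ 0 → δ ≤ (T.filter (fun j => c j ≠ 0)).card) :
    δ ≤ minDist (puncture C T) := by
  refine le_minDist ?_ ?_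
  · obtain ⟨c, hc, j, hj, h0⟩ := hne
    exact ⟨_, Submodule.mem_map_of_mem hc, fun h => h0 (by simpa using congrFun h ⟨j, hj⟩)⟩
  · rintro _ ⟨c, hc, rfl⟩ h0
    obtain ⟨⟨j, hj⟩, h1⟩ := Function.ne_iff.1 h0
    rw [hammingNorm_funLeft]
    exact h c hc j hj (by simpa using h1)

/-- Locality through the weights of codewords on the recovering sets. The all-one word ensures
that the restricted codes are not zero, the zero code having `minDist` equal to `0`. -/
theorem HasLocality.of_one_mem {n : ℕ} {C : Submodule F (Fin n → F)} {r δ : ℕ} (hr : 1 ≤ r)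
    (hδ : 1 ≤ δ) (hone : (fun _ => 1) ∈ C)
    (h : ∀ i : Fin n, ∃ T : Finset (Fin n), i ∈ T ∧ T.card ≤ r + δ - 1 ∧
      ∀ c ∈ C, ∀ j ∈ T, c j ≠ 0 → δ ≤ (T.filter (fun j => c j ≠ 0)).card) :
    HasLocality C r δ := by
  refine ⟨hr, hδ, fun i => ?_⟩
  obtain ⟨T, hi, hT, hw⟩ := h i
  exact ⟨T, hi, hT, le_minDist_puncture ⟨_, hone, i, hi, one_ne_zero⟩ hw⟩

theorem card_filter_coeff_ne_zero {n : ℕ} {f : F[X]} (hf : f.degree < n) (P : ℕ → Prop)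
    [DecidablePred P] :
    (Finset.univ.filter (fun j : Fin n => P j ∧ f.coeff j ≠ 0)).card =
      (f.support.filter P).card := by
  rw [← Finset.card_map Fin.valEmbedding]
  congr 1
  ext e
  simp only [Finset.mem_map, Finset.mem_filter, Finset.mem_univ, true_and, Fin.valEmbedding_apply,
    mem_support_iff]
  constructor
  · rintro ⟨j, ⟨h1, h2⟩, rfl⟩
    exact ⟨h2, h1⟩
  · rintro ⟨h1, h2⟩
    refine ⟨⟨e, ?_⟩, ⟨h2, h1⟩, rfl⟩
    by_contra h
    exact h1 ((degree_lt_iff_coeff_zero _ _).1 hf e (not_lt.1 h))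

theorem hammingNorm_eq_card_support {n : ℕ} {f : F[X]} (hf : f.degree < n) {c : Fin n → F}
    (hc : ∀ j : Fin n, c j = f.coeff j) : hammingNorm c = f.support.card := by
  have := card_filter_coeff_ne_zero hf (fun _ => True)
  simp only [true_and, Finset.filter_true] at this
  rw [← this, hammingNorm]
  simp only [hc]

theorem card_filter_mod_eq {u m b : ℕ} (hb : b < u) :
    (Finset.univ.filter (fun j : Fin (u * m) => (j : ℕ) % u = b)).card = m := by
  have hu : 0 < u := by omega
  have h : (Finset.univ.filter (fun j : Fin (u * m) => (j : ℕ) % u = b)).map Fin.valEmbedding =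
      (Finset.range m).image (fun l => b + u * l) := by
    ext e
    simp only [Finset.mem_map, Finset.mem_filter, Finset.mem_univ, true_and,
      Fin.valEmbedding_apply, Finset.mem_image, Finset.mem_range]
    constructor
    · rintro ⟨j, hj, rfl⟩
      exact ⟨j / u, Nat.div_lt_of_lt_mul j.2, by
        rw [← hj]; exact Nat.mod_add_div _ _⟩
    · rintro ⟨l, hl, rfl⟩
      exact ⟨⟨b + u * l, by nlinarith⟩, by simp [Nat.mod_eq_of_lt hb], rfl⟩
  rw [← Finset.card_map Fin.valEmbedding, h, Finset.card_image_of_injective, Finset.card_range]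
  intro x y hxy
  exact Nat.eq_of_mul_eq_mul_left hu (by simpa using hxy)

end Codes

/-! ### The codes `C_i` of length `p ^ s` -/

section RootCode

variable {F : Type*} [Field F]

theorem mem_rootCode_iff {n i : ℕ} (hn : (X - 1 : F[X]) ^ i ∣ X ^ n - 1) (c : Fin n → F) :
    c ∈ rootCode F n i ↔
      ∃ f : F[X], f.degree < n ∧ (X - 1) ^ i ∣ f ∧ ∀ j : Fin n, c j = f.coeff j := by
  have key : ∀ f : F[X], f.degree < n → (∀ j : Fin n, c j = f.coeff j) →
      (c ∈ rootCode F n i ↔ (X - 1) ^ i ∣ f) := by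
    intro f hf hc
    have h1 : polyRep F n c = Ideal.Quotient.mk (Ideal.span {(X ^ n - 1 : F[X])}) f := by
      have hsum : f = ∑ j : Fin n, C (f.coeff j) * X ^ (j : ℕ) := by
        rw [Fin.sum_univ_eq_sum_range (fun j => C (f.coeff j) * X ^ j) n]
        rcases eq_or_ne f 0 with rfl | h0
        · simp
        · exact as_sum_range_C_mul_X_pow' f ((natDegree_lt_iff_degree_lt h0).2 hf)
      conv_rhs => rw [hsum, map_sum]
      simp only [polyRep, LinearMap.sum_apply, LinearMap.smulRight_apply, LinearMap.proj_apply]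
      refine Finset.sum_congr rfl fun j _ => ?_
      rw [hc j, ← smul_eq_C_mul]
      rfl
    rw [rootCode, Submodule.mem_comap, Submodule.restrictScalars_mem, h1, Ideal.mem_span_singleton]
    constructor
    · rintro ⟨g, hg⟩
      obtain ⟨g, rfl⟩ := Ideal.Quotient.mk_surjective g
      rw [← map_mul, Ideal.Quotient.mk_eq_mk_iff_sub_mem, Ideal.mem_span_singleton] at hg
      exact (dvd_sub_left (dvd_mul_right _ _)).1 (hn.trans hg)
    · exact fun h => map_dvd _ h
  constructor
  · intro h
    set f := ((degreeLTEquiv F n).symm c : F[X]) with hf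
    have hfd : f.degree < n := mem_degreeLT.1 ((degreeLTEquiv F n).symm c).2
    have hfc : ∀ j : Fin n, c j = f.coeff j := fun j =>
      (congrFun ((degreeLTEquiv F n).apply_symm_apply c) j).symm
    exact ⟨f, hfd, (key f hfd hfc).1 h, hfc⟩
  · rintro ⟨f, hfd, hdvd, hfc⟩
    exact (key f hfd hfc).2 hdvd

variable {p : ℕ} [Fact p.Prime] [CharP F p]

theorem X_sub_one_pow_dvd {s i : ℕ} (hi : i ≤ p ^ s) : (X - 1 : F[X]) ^ i ∣ X ^ p ^ s - 1 := by
  rw [← X_sub_one_pow_prime_pow]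
  exact pow_dvd_pow _ hi

theorem coeff_mem_rootCode {s i : ℕ} (hi : i ≤ p ^ s) {f : F[X]}
    (hf : f.degree < (p ^ s : ℕ)) (h : (X - 1) ^ i ∣ f) :
    (fun j : Fin (p ^ s) => f.coeff j) ∈ rootCode F (p ^ s) i :=
  (mem_rootCode_iff (X_sub_one_pow_dvd hi) _).2 ⟨f, hf, h, fun _ => rfl⟩

theorem one_mem_rootCode {s i : ℕ} (hi : i < p ^ s) :
    (fun _ => 1) ∈ rootCode F (p ^ s) i := by
  have h1 := X_sub_one_pow_prime_pow_sub_one (F := F) (p := p) 0 s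
  rw [pow_zero, one_mul, pow_one] at h1
  refine (mem_rootCode_iff (X_sub_one_pow_dvd hi.le) _).2
    ⟨∑ b ∈ Finset.range (p ^ s), X ^ b, ?_, ?_, fun j => ?_⟩
  · rw [degree_lt_iff_coeff_zero]
    intro e he
    simp [coeff_X_pow, he]
  · rw [← h1]
    exact pow_dvd_pow _ (by omega)
  · simp [coeff_X_pow]

theorem finrank_rootCode {s i : ℕ} (hi : i ≤ p ^ s) :
    Module.finrank F (rootCode F (p ^ s) i) = p ^ s - i := by
  have hcast : i + (p ^ s - i) = p ^ s := by omega
  -- multiplication by `(X - 1) ^ i`, from the polynomials of degree less than `p ^ s - i`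
  let φ : degreeLT F (p ^ s - i) →ₗ[F] (Fin (p ^ s) → F) :=
    (LinearMap.pi fun j : Fin (p ^ s) => lcoeff F j) ∘ₗ
      (LinearMap.mulLeft F ((X - 1 : F[X]) ^ i)) ∘ₗ (degreeLT F (p ^ s - i)).subtype
  have hφ : ∀ g j, φ g j = ((X - 1) ^ i * (g : F[X])).coeff j := fun g j => rfl
  have hdeg : ∀ g : degreeLT F (p ^ s - i),
      ((X - 1) ^ i * (g : F[X])).degree < ((p ^ s : ℕ) : WithBot ℕ) := by
    intro g
    have := degree_X_sub_one_pow_mul_lt_iff (k := i) (g := (g : F[X])) |>.2 (mem_degreeLT.1 g.2)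
    rwa [hcast] at this
  have hX : (X - 1 : F[X]) ≠ 0 := by
    simpa using X_sub_C_ne_zero (1 : F)
  have hinj : Function.Injective φ := by
    rw [injective_iff_map_eq_zero]
    intro g hg
    have h0 : (X - 1) ^ i * (g : F[X]) = 0 := by
      ext e
      by_cases he : e < p ^ s
      · rw [← hφ g ⟨e, he⟩, hg]; simp
      · exact (degree_lt_iff_coeff_zero _ _).1 (hdeg g) e (not_lt.1 he)
    exact Subtype.ext ((mul_eq_zero.1 h0).resolve_left (pow_ne_zero i hX))
  have hrange : LinearMap.range φ = rootCode F (p ^ s) i := by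
    ext c
    rw [LinearMap.mem_range, mem_rootCode_iff (X_sub_one_pow_dvd hi)]
    constructor
    · rintro ⟨g, rfl⟩
      exact ⟨_, hdeg g, dvd_mul_right _ _, hφ g⟩
    · rintro ⟨_, hf, ⟨g, rfl⟩, hc⟩
      refine ⟨⟨g, mem_degreeLT.2 ?_⟩, funext fun j => (hc j).symm⟩
      rw [← degree_X_sub_one_pow_mul_lt_iff (k := i), hcast]
      exact hf
  rw [← hrange, LinearMap.finrank_range_of_inj hinj,
    LinearEquiv.finrank_eq (degreeLTEquiv F (p ^ s - i)), Module.finrank_fin_fun]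

variable [DecidableEq F]

theorem minDist_rootCode {m t a j : ℕ} (ha : a + 1 < p) (hj : a * p ^ m < j)
    (hj' : j ≤ (a + 1) * p ^ m) :
    minDist (rootCode F (p ^ (m + 1 + t)) (p ^ (m + 1 + t) - p ^ (m + 1) + j)) =
      (a + 2) * p ^ t := by
  have hp : 0 < p := (Fact.out : p.Prime).pos
  have hm := pow_pos hp m
  have h1 : (a + 1) * p ^ m < p ^ (m + 1) := by
    rw [pow_succ, mul_comm]
    exact Nat.mul_lt_mul_of_pos_left ha hm
  have h2 : p ^ (m + 1) ≤ p ^ (m + 1 + t) := Nat.pow_le_pow_right hp (by omega)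
  have hi : p ^ (m + 1 + t) - p ^ (m + 1) + j < p ^ (m + 1 + t) := by omega
  apply le_antisymm
  · set f : F[X] := (X - 1) ^ (p ^ (m + 1 + t) - p ^ (m + 1) + (a + 1) * p ^ m) with hf
    have hfd : f.degree < (p ^ (m + 1 + t) : ℕ) := by
      rw [hf, ← C_1, degree_pow, degree_X_sub_C, nsmul_one]
      norm_cast
      omega
    have hmem := coeff_mem_rootCode hi.le hfd (pow_dvd_pow _ (by omega))
    refine (minDist_le hmem fun h0 => ?_).trans ?_
    · have := congrFun h0 ⟨0, by omega⟩
      simp [hf, coeff_zero_eq_eval_zero] at this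
    · rw [hammingNorm_eq_card_support hfd fun _ => rfl, hf, pow_add p (m + 1) t]
      exact card_support_X_sub_one_pow_le m t (a + 1)
  · refine le_minDist ⟨_, one_mem_rootCode hi, fun h0 => ?_⟩ fun c hc h0 => ?_
    · simpa using congrFun h0 ⟨0, by omega⟩
    · obtain ⟨f, hfd, hdvd, hcf⟩ := (mem_rootCode_iff (X_sub_one_pow_dvd hi.le) _).1 hc
      rw [hammingNorm_eq_card_support hfd hcf]
      rw [pow_add p (m + 1) t] at hfd hdvd
      refine mul_le_card_support (fun hf => h0 (funext fun j => ?_)) hfd hj hdvd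
      rw [hcf, hf]; simp

/-- A code `C_i` of repeated words of length `p ^ m`, with the classes modulo `p ^ m` as recovering
sets. -/
theorem hasLocality_one_of_le {m t i : ℕ} (hi : p ^ (m + t) - p ^ m ≤ i) (hi' : i < p ^ (m + t)) :
    HasLocality (rootCode F (p ^ (m + t)) i) 1 (p ^ t) := by
  have hp : 0 < p := (Fact.out : p.Prime).pos
  have hm := pow_pos hp m
  refine HasLocality.of_one_mem le_rfl (pow_pos hp t) (one_mem_rootCode hi') fun i₀ => ?_
  have hcard : (Finset.univ.filter (fun j : Fin (p ^ (m + t)) =>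
      (j : ℕ) % p ^ m = i₀ % p ^ m)).card = p ^ t := by
    have : ∀ n, n = p ^ m * p ^ t → (Finset.univ.filter (fun j : Fin n =>
        (j : ℕ) % p ^ m = i₀ % p ^ m)).card = p ^ t := by
      rintro _ rfl
      exact card_filter_mod_eq (Nat.mod_lt _ hm)
    exact this _ (pow_add _ _ _)
  refine ⟨Finset.univ.filter (fun j => (j : ℕ) % p ^ m = i₀ % p ^ m), by simp, by omega, ?_⟩
  intro c hc j hj h0
  obtain ⟨f, hfd, hdvd, hcf⟩ := (mem_rootCode_iff (X_sub_one_pow_dvd hi'.le) _).1 hc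
  rw [pow_add] at hfd hi
  obtain ⟨g, hg, -, rfl⟩ := exists_eq_geom_sum_mul (j := 0) hfd ((pow_dvd_pow _ hi).trans hdvd)
  rw [Finset.filter_true_of_mem, hcard]
  intro j' hj'
  simp only [Finset.mem_filter, Finset.mem_univ, true_and] at hj hj'
  have hlt : ∀ j : Fin (p ^ (m + t)), (j : ℕ) < p ^ m * p ^ t := fun j => by
    rw [← pow_add]; exact j.2
  rw [hcf, coeff_geom_sum_mul hg (hlt _), hj] at h0
  rwa [hcf, coeff_geom_sum_mul hg (hlt _), hj']

/-- The classes modulo `p ^ m` as recovering sets of size `p`. A codeword which does not vanish on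
such a class has there at least `a + 1` nonzero coordinates. -/
theorem hasLocality_of_mul_le {m a r δ i : ℕ} (hr : 1 ≤ r) (hrδ : r + δ = p + 1)
    (hδ : δ = a + 1) (hi : a * p ^ m ≤ i) (hi' : i < p ^ (m + 1)) :
    HasLocality (rootCode F (p ^ (m + 1)) i) r δ := by
  have hp : 0 < p := (Fact.out : p.Prime).pos
  have hm := pow_pos hp m
  refine HasLocality.of_one_mem hr (by omega) (one_mem_rootCode hi') fun i₀ => ?_
  have hcard : (Finset.univ.filter (fun j : Fin (p ^ (m + 1)) =>
      (j : ℕ) % p ^ m = i₀ % p ^ m)).card = p :=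
    card_filter_mod_eq (Nat.mod_lt _ hm)
  refine ⟨Finset.univ.filter (fun j => (j : ℕ) % p ^ m = i₀ % p ^ m), by simp, by omega, ?_⟩
  intro c hc j hj h0
  simp only [Finset.mem_filter, Finset.mem_univ, true_and] at hj
  obtain ⟨f, hfd, hdvd, hcf⟩ := (mem_rootCode_iff (X_sub_one_pow_dvd hi'.le) _).1 hc
  simp only [hcf] at h0 ⊢
  rw [Finset.filter_filter, card_filter_coeff_ne_zero hfd (fun e => e % p ^ m = i₀ % p ^ m), hδ,
    ← hj]
  refine succ_le_card_filter_support (p := p) hm (fun e he => ?_) ?_ h0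
  · by_contra h4
    rw [not_lt, mul_comm, ← pow_succ] at h4
    exact mem_support_iff.1 he ((degree_lt_iff_coeff_zero _ _).1 hfd e h4)
  · rw [← X_sub_one_pow_prime_pow, ← pow_mul, mul_comm]
    exact (pow_dvd_pow _ hi).trans hdvd

/-- Locality of a code with `d ≥ n - k + 1` and `k ≤ r`: any `k + δ - 1` coordinates form a
recovering set, since restricting to them loses only `n - k + 1 - δ` coordinates. -/
theorem HasLocality.of_le_minDist {n r δ k : ℕ} {C : Submodule F (Fin n → F)} (hr : 1 ≤ r)
    (hδ : 1 ≤ δ) (hone : (fun _ => 1) ∈ C) (hk : 1 ≤ k) (hkr : k ≤ r) (hkn : k + δ ≤ n + 1)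
    (hd : n + 1 ≤ k + minDist C) : HasLocality C r δ := by
  refine HasLocality.of_one_mem hr hδ hone fun i₀ => ?_
  obtain ⟨T, hT1, -, hT2⟩ := Finset.exists_subsuperset_card_eq (n := k + δ - 1)
    (Finset.subset_univ {i₀}) (by rw [Finset.card_singleton]; omega) (by simp; omega)
  refine ⟨T, hT1 (by simp), by omega, fun c hc j hj h0 => ?_⟩
  have h1 := minDist_le hc (fun h => h0 (by simp [h]))
  have h2 : hammingNorm c ≤ (T.filter (fun j => c j ≠ 0)).card + Tᶜ.card := by
    refine le_trans (Finset.card_le_card ?_) (Finset.card_union_le _ _)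
    intro j hj
    have : c j ≠ 0 := by simpa using hj
    simp [this, em]
  rw [Finset.card_compl, Fintype.card_fin, hT2] at h2
  omega

/-- Constraints imposed by a recovering set of a code `C_i` with `i = n - n' + j`, `n' = p * u`,
`u = p ^ m` and `j ≤ (a + 1) * u`, a `p ^ t`-fold repetition of a code of length `n'`. If `δ`
exceeds `p ^ t`, then `r` is at least the number `q` of positions of that shorter code which are
always independent: otherwise interpolation produces a codeword of weight between `1` and `δ - 1`
on the recovering set. -/
theorem HasLocality.bounds {m t a j r δ : ℕ} (ha : a + 1 < p)
    (hj' : j ≤ (a + 1) * p ^ m)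
    (h : HasLocality (rootCode F (p ^ (m + 1 + t)) (p ^ (m + 1 + t) - p ^ (m + 1) + j)) r δ) :
    δ ≤ (a + 2) * p ^ t ∧ (p ^ t < δ → p ≤ r + (a + 1) ∧ (j < (a + 1) * p ^ m → p ≤ r + a)) := by
  have hp : 0 < p := (Fact.out : p.Prime).pos
  have hm := pow_pos hp m
  have h1 : (a + 1) * p ^ m < p ^ (m + 1) := by
    rw [pow_succ, mul_comm]
    exact Nat.mul_lt_mul_of_pos_left ha hm
  have h2 : p ^ (m + 1) ≤ p ^ (m + 1 + t) := Nat.pow_le_pow_right hp (by omega)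
  have hi : p ^ (m + 1 + t) - p ^ (m + 1) + j < p ^ (m + 1 + t) := by omega
  obtain ⟨hr, hδ, hloc⟩ := h
  obtain ⟨T, h0T, hTc, hTd⟩ := hloc ⟨0, by omega⟩
  refine ⟨?_, fun hδt => ?_⟩
  · set f : F[X] := (X - 1) ^ (p ^ (m + 1 + t) - p ^ (m + 1) + (a + 1) * p ^ m) with hf
    have hfd : f.degree < (p ^ (m + 1 + t) : ℕ) := by
      rw [hf, ← C_1, degree_pow, degree_X_sub_C, nsmul_one]
      norm_cast
      omega
    have hmem := coeff_mem_rootCode hi.le hfd (pow_dvd_pow _ (by omega))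
    refine hTd.trans ((minDist_puncture_le hmem h0T ?_).trans ?_)
    · simp [hf, coeff_zero_eq_eval_zero]
    · refine (Finset.card_le_card (Finset.filter_subset_filter _ (Finset.subset_univ T))).trans ?_
      rw [show (Finset.univ.filter fun j : Fin (p ^ (m + 1 + t)) => f.coeff j ≠ 0).card
        = f.support.card from hammingNorm_eq_card_support (c := fun j : Fin _ => f.coeff j) hfd
          fun _ => rfl, hf, pow_add p (m + 1) t]
      exact card_support_X_sub_one_pow_le m t (a + 1)
  · -- any `q` positions of the repeated word are independent
    have key : ∀ q, 1 ≤ q → (q + (a + 1) ≤ p ∨ j < (a + 1) * p ^ m ∧ q + (a + 1) ≤ p + 1) →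
        q ≤ r := by
      intro q hq hqp
      by_contra! hrq
      set T' := T.image (fun e : Fin _ => (e : ℕ) % p ^ (m + 1)) with hT'
      have h0T' : 0 ∈ T' := Finset.mem_image.2 ⟨_, h0T, by simp⟩
      obtain ⟨S, hS0, hST, hScard⟩ := Finset.exists_subsuperset_card_eq
        (n := min q T'.card) (Finset.singleton_subset_iff.2 h0T')
        (by rw [Finset.card_singleton]; exact le_min hq (Finset.card_pos.2 ⟨0, h0T'⟩))
        (min_le_right _ _)
      obtain ⟨g, hg, hgd, hg0, hgS⟩ := exists_interpolation (F := F) (p := p) (m := m)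
        (τ := a + 1) (j := j) (j₀ := 0) (by omega) S (hS0 (by simp))
        (fun e he => by
          obtain ⟨e', -, rfl⟩ := Finset.mem_image.1 (hST he)
          exact Nat.mod_lt _ (pow_pos hp _)) hj'
        (hqp.imp (fun h => by have := min_le_left q T'.card; omega)
          (fun h => ⟨h.1, by have := min_le_left q T'.card; omega⟩))
      set f := (∑ b ∈ Finset.range (p ^ t), (X ^ p ^ (m + 1)) ^ b) * g with hf
      have hfe : f = (X - 1) ^ (p ^ (m + 1) * p ^ t - p ^ (m + 1)) * g := by
        rw [hf, X_sub_one_pow_prime_pow_sub_one]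
      have hfd : f.degree < (p ^ (m + 1 + t) : ℕ) := by
        have := (degree_X_sub_one_pow_mul_lt_iff
          (k := p ^ (m + 1) * p ^ t - p ^ (m + 1)) (g := g)).2 hg
        rwa [← hfe, ← pow_add, Nat.sub_add_cancel h2] at this
      have hmem := coeff_mem_rootCode hi.le hfd (by
        rw [hfe, ← pow_add, pow_add (X - 1 : F[X])]
        exact mul_dvd_mul_left _ hgd)
      have hfc : ∀ e : Fin (p ^ (m + 1 + t)), f.coeff e = g.coeff (e % p ^ (m + 1)) := fun e =>
        coeff_geom_sum_mul hg (by rw [← pow_add]; exact e.2)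
      have hle := hTd.trans (minDist_puncture_le hmem h0T (by rw [hfc]; simpa using hg0))
      simp only [hfc] at hle
      rcases le_total T'.card q with hT'q | hT'q
      · -- the word vanishes on `T` outside of the class of `0`
        have hSe : S = T' := Finset.eq_of_subset_of_card_le hST (by rw [hScard, min_eq_right hT'q])
        have hsub : T.filter (fun e : Fin _ => g.coeff ((e : ℕ) % p ^ (m + 1)) ≠ 0) ⊆
            Finset.univ.filter (fun e : Fin _ => (e : ℕ) % p ^ (m + 1) = 0) := by
          intro e he
          rw [Finset.mem_filter] at he
          simp only [Finset.mem_filter, Finset.mem_univ, true_and]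
          by_contra hne
          exact he.2 (hgS _ (hSe ▸ Finset.mem_image_of_mem _ he.1) hne)
        have hcard : (Finset.univ.filter (fun j : Fin (p ^ (m + 1 + t)) =>
            (j : ℕ) % p ^ (m + 1) = 0)).card = p ^ t := by
          have : ∀ n, n = p ^ (m + 1) * p ^ t → (Finset.univ.filter (fun j : Fin n =>
              (j : ℕ) % p ^ (m + 1) = 0)).card = p ^ t := by
            rintro _ rfl
            exact card_filter_mod_eq (pow_pos hp _)
          exact this _ (pow_add _ _ _)
        have := Finset.card_le_card hsub
        omega
      · -- the word vanishes on at least `q - 1` elements of `T`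
        rw [min_eq_left hT'q] at hScard
        have hsub : S.erase 0 ⊆
            (T.filter (fun e : Fin _ => ¬g.coeff ((e : ℕ) % p ^ (m + 1)) ≠ 0)).image
            (fun e : Fin _ => (e : ℕ) % p ^ (m + 1)) := by
          intro e he
          obtain ⟨he0, heS⟩ := Finset.mem_erase.1 he
          obtain ⟨e', he', rfl⟩ := Finset.mem_image.1 (hST heS)
          exact Finset.mem_image.2 ⟨e', Finset.mem_filter.2
            ⟨he', not_not.2 (hgS _ heS he0)⟩, rfl⟩
        have h3 := (Finset.card_le_card hsub).trans Finset.card_image_le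
        rw [Finset.card_erase_of_mem (hS0 (by simp)), hScard] at h3
        have h4 := Finset.card_filter_add_card_filter_not (s := T)
          (fun e : Fin (p ^ (m + 1 + t)) => g.coeff ((e : ℕ) % p ^ (m + 1)) ≠ 0)
        omega
    refine ⟨?_, fun hlt => ?_⟩
    · have := key (p - (a + 1)) (by omega) (Or.inl (by omega))
      omega
    · have := key (p - a) (by omega) (Or.inr ⟨hlt, by omega⟩)
      omega

end RootCode

/-! ### The parameters of the optimal codes -/

section Parameters

/-- The arithmetic of the Singleton-type bound for `n = p * u * P`, `k = p * u - j`,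
`d = (τ + 1) * P` and `q = ⌈k / r⌉ - 1`. In each case the locality constraints bound `q * (δ - 1)`
by the value that equality prescribes, and the difference is a sum of nonnegative terms, all of
which therefore vanish. -/
theorem eq_cases_of_singleton_eq {p u P τ j r δ q k : ℤ} (hu : u = 1 ∨ p ≤ u) (hP : 1 ≤ P)
    (hτ : 1 ≤ τ) (hτp : τ < p) (hj : (τ - 1) * u < j) (hj' : j ≤ τ * u) (hδ : 2 ≤ δ) (hr : 1 ≤ r)
    (hδ1 : δ ≤ (τ + 1) * P) (hδ2 : j = τ * u ∨ δ ≤ τ * P)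
    (hloc : P < δ → p ≤ r + τ ∧ (j < τ * u → p + 1 ≤ r + τ))
    (hk : k = p * u - j) (hq0 : 0 ≤ q) (hq : q * r < k) (hq' : k ≤ (q + 1) * r)
    (heq : (τ + 1) * P + q * (δ - 1) + k = p * u * P + 1) :
    k = 1 ∨ (u = 1 ∧ j = τ ∧ r = 1 ∧ δ = P) ∨ (τ = 1 ∧ p ≤ u ∧ j = 1 ∧ r = 1 ∧ δ = P) ∨
      (P = 1 ∧ u = 1 ∧ j = τ ∧ k ≤ r ∧ δ ≤ τ + 1) ∨
      (τ = p - 1 ∧ j = τ * u ∧ r = 1 ∧ δ = p * P) ∨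
      (P = 1 ∧ j = τ * u ∧ r = p - τ ∧ δ = τ + 1) ∨
      (P = 1 ∧ 2 ≤ τ ∧ j = (τ - 1) * u + 1 ∧ r = p - τ + 1 ∧ δ = τ) := by
  have hu1 : 1 ≤ u := by omega
  rcases le_or_gt δ P with hδP | hδP
  -- `q ≤ k - 1` suffices here, without any condition on `r`
  · have hjτ : τ ≤ j := by nlinarith
    have hqk : q ≤ k - 1 := by nlinarith
    have h1 : 0 ≤ q * (P - δ) := mul_nonneg hq0 (by omega)
    have h2 : 0 ≤ p * u - τ - 1 - q := by omega
    have h3 := mul_nonneg h2 (by omega : 0 ≤ P - 1)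
    have h4 : q * (P - δ) + (p * u - τ - 1 - q) * (P - 1) + (j - τ) = 0 := by
      rw [hk] at heq
      linear_combination -heq
    have h5 : j = τ := by omega
    have h6 : p * u - τ - 1 - q = 0 :=
      (mul_eq_zero.1 (by omega : (p * u - τ - 1 - q) * (P - 1) = 0)).resolve_right (by omega)
    rcases mul_eq_zero.1 (by omega : q * (P - δ) = 0) with h7 | h7
    · left; omega
    · by_cases hq1 : q = 0
      · left; omega
      have hr1 : r = 1 := by
        by_contra hne
        have : q * 2 ≤ q * r := mul_le_mul_of_nonneg_left (by omega) hq0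
        omega
      rcases hu with hu | hu
      · exact Or.inr (Or.inl ⟨hu, h5, hr1, by omega⟩)
      · have : τ = 1 := by nlinarith
        exact Or.inr (Or.inr (Or.inl ⟨this, hu, by omega, hr1, by omega⟩))
  · obtain ⟨hr1, hr2⟩ := hloc hδP
    rcases eq_or_lt_of_le hj' with htop | htop
    · have hqu : q < u := by
        have : q * r < u * r := by nlinarith
        exact lt_of_mul_lt_mul_right this (by omega)
      have hpos : 1 ≤ (τ + 1) * P - 1 := by nlinarith
      have h1 : 0 ≤ (u - 1 - q) * ((τ + 1) * P - 1) := mul_nonneg (by omega) (by omega)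
      have h2 : 0 ≤ q * ((τ + 1) * P - δ) := mul_nonneg hq0 (by omega)
      have h3 : 0 ≤ (p - τ - 1) * (P - 1) := mul_nonneg (by omega) (by omega)
      have h3' := mul_nonneg (by omega : 0 ≤ u) h3
      have h4 : (u - 1 - q) * ((τ + 1) * P - 1) + q * ((τ + 1) * P - δ) +
          u * ((p - τ - 1) * (P - 1)) = 0 := by
        rw [hk, htop] at heq
        linear_combination -heq
      have h5 : u - 1 - q = 0 := (mul_eq_zero.1
        (by omega : (u - 1 - q) * ((τ + 1) * P - 1) = 0)).resolve_right (by omega)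
      have h6 : (p - τ - 1) * (P - 1) = 0 := (mul_eq_zero.1
        (by omega : u * ((p - τ - 1) * (P - 1)) = 0)).resolve_left (by omega)
      rcases hu with hu | hu
      · subst hu
        rw [mul_eq_zero] at h6
        rcases h6 with h6 | h6
        · left; omega
        · refine Or.inr (Or.inr (Or.inr (Or.inl ⟨by omega, rfl, by omega, ?_, ?_⟩)))
          · rw [show q = 0 by omega] at hq'; omega
          · rw [show P = 1 by omega] at hδ1; omega
      · have h7 : (τ + 1) * P - δ = 0 := (mul_eq_zero.1
          (by omega : q * ((τ + 1) * P - δ) = 0)).resolve_left (by omega)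
        have h8 : r = p - τ := by
          by_contra hne
          have h9 : p - τ + 1 ≤ r := by omega
          have h10 : (u - 1) * (p - τ + 1) ≤ (u - 1) * r :=
            mul_le_mul_of_nonneg_left h9 (by omega)
          rw [show q = u - 1 by omega, hk, htop] at hq
          nlinarith
        rcases mul_eq_zero.1 h6 with h6 | h6
        · refine Or.inr (Or.inr (Or.inr (Or.inr (Or.inl ⟨by omega, htop, by omega, ?_⟩))))
          rw [show p = τ + 1 by omega]; omega
        · refine Or.inr (Or.inr (Or.inr (Or.inr (Or.inr (Or.inl ⟨by omega, htop, h8, ?_⟩)))))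
          rw [show P = 1 by omega] at h7; omega
    · have hr3 := hr2 htop
      have hδ3 := hδ2.resolve_left htop.ne
      have hup : p ≤ u := by
        rcases hu with hu | hu
        · subst hu; omega
        · exact hu
      have hku : k ≤ (p - τ + 1) * u - 1 := by rw [hk]; linarith
      have hqu : q < u := by
        have : q * r < u * r := by nlinarith
        exact lt_of_mul_lt_mul_right this (by omega)
      have h1 : 0 ≤ (u - 1 - q) * (τ * P - 1) := mul_nonneg (by omega) (by omega)
      have h2 : 0 ≤ q * (τ * P - δ) := mul_nonneg hq0 (by omega)
      have hpu : 2 ≤ (p - τ) * u := by nlinarith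
      have h3 : 0 ≤ ((p - τ) * u - 1) * (P - 1) := mul_nonneg (by omega) (by omega)
      have h4 : (u - 1 - q) * (τ * P - 1) + q * (τ * P - δ) + ((p - τ) * u - 1) * (P - 1) +
          (j - (τ - 1) * u - 1) = 0 := by
        rw [hk] at heq
        linear_combination -heq
      have h5 : u - 1 - q = 0 := (mul_eq_zero.1
        (by omega : (u - 1 - q) * (τ * P - 1) = 0)).resolve_right (by omega)
      have h6 : P - 1 = 0 := (mul_eq_zero.1
        (by omega : ((p - τ) * u - 1) * (P - 1) = 0)).resolve_left (by omega)
      have h7 : τ * P - δ = 0 := (mul_eq_zero.1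
        (by omega : q * (τ * P - δ) = 0)).resolve_left (by omega)
      rw [show P = 1 by omega, mul_one] at h7
      have hjeq : j = (τ - 1) * u + 1 := by omega
      have h8 : r = p - τ + 1 := by
        by_contra hne
        have h9 : p - τ + 2 ≤ r := by omega
        have h10 : (u - 1) * (p - τ + 2) ≤ (u - 1) * r :=
          mul_le_mul_of_nonneg_left h9 (by omega)
        rw [show q = u - 1 by omega, hk, hjeq] at hq
        nlinarith
      exact Or.inr (Or.inr (Or.inr (Or.inr (Or.inr (Or.inr
        ⟨by omega, by omega, hjeq, h8, by omega⟩)))))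

variable {F : Type*} [Field F] [DecidableEq F]

/-- The Singleton-type equality with `q = ⌈k / r⌉ - 1`. -/
theorem isOptimalLRC_iff {n k d q r δ : ℕ} {C : Submodule F (Fin n → F)}
    (hk : Module.finrank F C = k) (hd : minDist C = d) (hq : q * r < k) (hq' : k ≤ (q + 1) * r) :
    IsOptimalLRC C r δ ↔ HasLocality C r δ ∧ (d : ℤ) + q * ((δ : ℤ) - 1) + k = n + 1 := by
  have hr : 0 < r := Nat.pos_of_ne_zero (by rintro rfl; simp at hq'; omega)
  have hceil : ⌈(k : ℚ) / (r : ℚ)⌉ = (q : ℤ) + 1 := by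
    have hr' : (0 : ℚ) < r := by exact_mod_cast hr
    rw [Int.ceil_eq_iff, lt_div_iff₀ hr', div_le_iff₀ hr']
    push_cast
    refine ⟨?_, by exact_mod_cast hq'⟩
    rw [add_sub_cancel_right]
    exact_mod_cast hq
  rw [IsOptimalLRC, hk, hd, hceil]
  refine and_congr_right fun _ => ⟨fun h => ?_, fun h => ?_⟩
  · rw [h]; ring
  · linear_combination h

variable {p : ℕ} [Fact p.Prime] [CharP F p]

theorem isOptimalWithParams_rootCode {s i m t a j k d r δ q : ℕ} (hs : s = m + 1 + t)
    (hi : i = p ^ s - p ^ (m + 1) + j) (ha : a + 1 < p) (hj : a * p ^ m < j)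
    (hj' : j ≤ (a + 1) * p ^ m) (hk : k + i = p ^ s) (hd : d = (a + 2) * p ^ t)
    (hloc : HasLocality (rootCode F (p ^ s) i) r δ) (hq : q * r < k) (hq' : k ≤ (q + 1) * r)
    (heq : (d : ℤ) + q * ((δ : ℤ) - 1) + k = (p : ℤ) ^ s + 1) :
    IsOptimalWithParams (rootCode F (p ^ s) i) k d r δ := by
  have h1 : Module.finrank F (rootCode F (p ^ s) i) = k := by
    rw [finrank_rootCode (by omega)]; omega
  have h2 : minDist (rootCode F (p ^ s) i) = d := by
    rw [hi, hs, minDist_rootCode ha hj hj', hd]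
  exact ⟨h1, h2, (isOptimalLRC_iff h1 h2 hq hq').2 ⟨hloc, by push_cast; exact heq⟩⟩

variable (F p)

/-- Repetitions of the MDS codes of length `p`. -/
theorem optimal_mds_repeated {s τ : ℕ} (hs : 1 < s) (hτ : 1 ≤ τ) (hτp : τ ≤ p - 1) :
    IsOptimalWithParams (rootCode F (p ^ s) (p ^ s - p + τ))
      (p - τ) ((τ + 1) * p ^ (s - 1)) 1 (p ^ (s - 1)) := by
  have hp : 2 ≤ p := (Fact.out : p.Prime).two_le
  obtain ⟨t, rfl⟩ : ∃ t, s = 1 + t := ⟨s - 1, by omega⟩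
  obtain ⟨c, hc⟩ : ∃ c, p = τ + c + 1 := ⟨p - τ - 1, by omega⟩
  have hle : p ≤ p ^ (1 + t) := Nat.le_self_pow (by omega) p
  rw [Nat.add_sub_cancel_left]
  refine isOptimalWithParams_rootCode (m := 0) (t := t) (a := τ - 1) (j := τ) (q := c) (by omega)
    (by simp) (by omega) (by simp; omega) (by simp; omega) (by omega)
    (by rw [show τ - 1 + 2 = τ + 1 by omega])
    (hasLocality_one_of_le (by rw [pow_one]; omega) (by omega)) (by omega) (by omega) ?_
  have hc' : (p : ℤ) = τ + c + 1 := by exact_mod_cast hc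
  rw [show p - τ = c + 1 by omega, pow_add, pow_one]
  push_cast
  linear_combination (-(p : ℤ) ^ t) * hc'

/-- Repetitions of the full space of length `p ^ (s - t - 1)`. -/
theorem optimal_full_space_repeated {s t : ℕ} (ht : t < s) :
    IsOptimalWithParams (rootCode F (p ^ s) (p ^ s - p ^ (s - t - 1)))
      (p ^ (s - t - 1)) (p ^ (t + 1)) 1 (p ^ (t + 1)) := by
  have hp : 2 ≤ p := (Fact.out : p.Prime).two_le
  obtain ⟨m, rfl⟩ : ∃ m, s = m + (t + 1) := ⟨s - t - 1, by omega⟩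
  rw [show m + (t + 1) - t - 1 = m by omega]
  have hu : 0 < p ^ m := pow_pos (by omega) m
  have hle : p ^ (m + 1) ≤ p ^ (m + (t + 1)) := Nat.pow_le_pow_right (by omega) (by omega)
  obtain ⟨b, rfl⟩ : ∃ b, p = b + 2 := ⟨p - 2, by omega⟩
  have hpm : (b + 2) ^ (m + 1) = (b + 1) * (b + 2) ^ m + (b + 2) ^ m := by ring
  have hbm : (b + 1) * (b + 2) ^ m = b * (b + 2) ^ m + (b + 2) ^ m := by ring
  refine isOptimalWithParams_rootCode (m := m) (t := t) (a := b)
    (j := (b + 1) * (b + 2) ^ m) (q := (b + 2) ^ m - 1) (by omega)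
    (by omega) (by omega) (by omega) le_rfl (by omega) (by ring)
    (hasLocality_one_of_le (by omega) (by omega)) (by omega) (by omega) ?_
  rw [Nat.cast_sub hu]
  push_cast
  ring

/-- The MDS codes of length `p`. -/
theorem optimal_mds {τ r δ : ℕ} (hτ : 1 ≤ τ) (hτp : τ ≤ p - 1) (hr : p - τ ≤ r) (hδ : 1 ≤ δ)
    (hδ' : δ ≤ τ + 1) :
    IsOptimalWithParams (rootCode F p τ) (p - τ) (τ + 1) r δ := by
  have hp : 2 ≤ p := (Fact.out : p.Prime).two_le
  have hmin : minDist (rootCode F (p ^ 1) τ) = τ + 1 := by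
    have := minDist_rootCode (F := F) (p := p) (m := 0) (t := 0) (a := τ - 1) (j := τ) (by omega)
      (by simp; omega) (by simp; omega)
    simp only [zero_add, add_zero, Nat.sub_self, pow_zero, mul_one] at this
    rw [this]; omega
  have := isOptimalWithParams_rootCode (F := F) (p := p) (s := 1) (i := τ) (m := 0) (t := 0)
    (a := τ - 1) (j := τ) (q := 0) (k := p - τ) (d := τ + 1) (r := r) (δ := δ) (by omega)
    (by simp) (by omega) (by simp; omega) (by simp; omega) (by rw [pow_one]; omega)
    (by simp; omega)
    (HasLocality.of_le_minDist (k := p - τ) (by omega) hδ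
      (one_mem_rootCode (by rw [pow_one]; omega)) (by omega) hr (by rw [pow_one]; omega)
      (by rw [hmin, pow_one]; omega)) (by omega) (by omega)
    (by rw [Nat.cast_sub (by omega)]; push_cast; ring)
  rwa [pow_one] at this

/-- Words all of whose sections modulo `p ^ (s - 1)` lie in an MDS code. -/
theorem optimal_mds_sections {s τ : ℕ} (hs : 1 ≤ s) (hτ : 1 ≤ τ) (hτp : τ ≤ p - 2) :
    IsOptimalWithParams (rootCode F (p ^ s) (τ * p ^ (s - 1)))
      ((p - τ) * p ^ (s - 1)) (τ + 1) (p - τ) (τ + 1) := by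
  have hp : 2 ≤ p := (Fact.out : p.Prime).two_le
  obtain ⟨m, rfl⟩ : ∃ m, s = m + 1 := ⟨s - 1, by omega⟩
  obtain ⟨c, hc⟩ : ∃ c, p = τ + c + 1 := ⟨p - τ - 1, by omega⟩
  rw [Nat.add_sub_cancel, show p - τ = c + 1 by omega]
  have hu : 0 < p ^ m := pow_pos (by omega) m
  have hn : p ^ (m + 1) = τ * p ^ m + c * p ^ m + p ^ m := by
    rw [pow_succ]; nth_rewrite 2 [hc]; ring
  obtain ⟨a, rfl⟩ : ∃ a, τ = a + 1 := ⟨τ - 1, by omega⟩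
  have hτu : (a + 1) * p ^ m = a * p ^ m + p ^ m := by ring
  have hcu : (c + 1) * p ^ m = c * p ^ m + p ^ m := by ring
  refine isOptimalWithParams_rootCode (m := m) (t := 0) (a := a)
    (j := (a + 1) * p ^ m) (q := p ^ m - 1) (by omega)
    (by omega) (by omega) (by omega) le_rfl (by omega) (by simp)
    (hasLocality_of_mul_le (a := a + 1) (by omega) (by omega) rfl le_rfl (by omega)) ?_ ?_ ?_
  · rw [mul_comm]
    exact Nat.mul_lt_mul_of_pos_left (by omega) (by omega)
  · rw [Nat.sub_add_cancel hu, mul_comm]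
  · have hn' : (p : ℤ) ^ (m + 1) = (a + 1) * p ^ m + c * p ^ m + p ^ m := by exact_mod_cast hn
    rw [Nat.cast_sub hu, hn']
    push_cast
    ring

/-- Repetitions of the code of words of length `p ^ (s - t)` with coordinate sum zero. -/
theorem optimal_sum_zero_repeated {s t : ℕ} (ht : t + 2 ≤ s) :
    IsOptimalWithParams (rootCode F (p ^ s) (p ^ s - p ^ (s - t) + 1))
      (p ^ (s - t) - 1) (2 * p ^ t) 1 (p ^ t) := by
  have hp : 2 ≤ p := (Fact.out : p.Prime).two_le
  obtain ⟨m, rfl⟩ : ∃ m, s = m + 1 + t := ⟨s - t - 1, by omega⟩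
  rw [Nat.add_sub_cancel]
  have hu : 0 < p ^ m := pow_pos (by omega) m
  have hm : 2 ≤ p ^ (m + 1) := hp.trans (Nat.le_self_pow (by omega) p)
  have hle : p ^ (m + 1) ≤ p ^ (m + 1 + t) := Nat.pow_le_pow_right (by omega) (by omega)
  refine isOptimalWithParams_rootCode (m := m) (t := t) (a := 0) (j := 1)
    (q := p ^ (m + 1) - 2) rfl rfl (by omega) (by simp) (by omega) (by omega) (by ring)
    (hasLocality_one_of_le (by omega) (by omega)) (by omega) (by omega) ?_
  rw [Nat.cast_sub hm, Nat.cast_sub (by omega)]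
  push_cast
  ring

/-- Words all of whose sections modulo `p ^ (s - 1)` lie in an MDS code, with one further linear
condition, which raises the minimum distance by one. -/
theorem optimal_mds_sections_sum_zero {s τ : ℕ} (hs : 1 ≤ s) (hτ : 2 ≤ τ) (hτp : τ ≤ p - 1) :
    IsOptimalWithParams (rootCode F (p ^ s) ((τ - 1) * p ^ (s - 1) + 1))
      ((p - τ + 1) * p ^ (s - 1) - 1) (τ + 1) (p - τ + 1) τ := by
  have hp : 2 ≤ p := (Fact.out : p.Prime).two_le
  obtain ⟨m, rfl⟩ : ∃ m, s = m + 1 := ⟨s - 1, by omega⟩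
  obtain ⟨c, hc⟩ : ∃ c, p = τ + c + 1 := ⟨p - τ - 1, by omega⟩
  rw [Nat.add_sub_cancel, show p - τ + 1 = c + 2 by omega]
  have hu : 0 < p ^ m := pow_pos (by omega) m
  have hn : p ^ (m + 1) = τ * p ^ m + c * p ^ m + p ^ m := by
    rw [pow_succ]; nth_rewrite 2 [hc]; ring
  obtain ⟨a, rfl⟩ : ∃ a, τ = a + 1 := ⟨τ - 1, by omega⟩
  rw [Nat.add_sub_cancel]
  have hτu : (a + 1) * p ^ m = a * p ^ m + p ^ m := by ring
  have hcu : (c + 2) * p ^ m = c * p ^ m + 2 * p ^ m := by ring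
  refine isOptimalWithParams_rootCode (m := m) (t := 0) (a := a)
    (j := a * p ^ m + 1) (q := p ^ m - 1) (by omega)
    (by omega) (by omega) (by omega) (by omega) (by omega) (by simp)
    (hasLocality_of_mul_le (a := a) (by omega) (by omega) rfl (by omega) (by omega)) ?_ ?_ ?_
  · have : (p ^ m - 1) * (c + 2) = (c + 2) * p ^ m - (c + 2) := by
      rw [Nat.sub_mul, one_mul, mul_comm]
    have : c + 2 ≤ (c + 2) * p ^ m := Nat.le_mul_of_pos_right _ hu
    omega
  · rw [Nat.sub_add_cancel hu, mul_comm]; omega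
  · have hn' : (p : ℤ) ^ (m + 1) = (a + 1) * p ^ m + c * p ^ m + p ^ m := by exact_mod_cast hn
    rw [Nat.cast_sub hu, Nat.cast_sub (by omega), hn']
    push_cast
    ring

/-- The repetition code. -/
theorem optimal_repetition {s r δ : ℕ} (hr : 1 ≤ r) (hδ : 1 ≤ δ) (hδ' : δ ≤ p ^ s)
    (hs : 1 ≤ s) : IsOptimalLRC (rootCode F (p ^ s) (p ^ s - 1)) r δ := by
  have hp : 2 ≤ p := (Fact.out : p.Prime).two_le
  obtain ⟨h1, h2, -⟩ := optimal_full_space_repeated F p (s := s) (t := s - 1) (by omega)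
  rw [show s - (s - 1) - 1 = 0 by omega, pow_zero] at h1 h2
  rw [Nat.sub_add_cancel hs] at h2
  rw [isOptimalLRC_iff (q := 0) h1 h2 (by omega) (by omega)]
  refine ⟨HasLocality.of_le_minDist (k := 1) hr hδ (one_mem_rootCode ?_) le_rfl hr (by omega)
    (by omega), by push_cast; ring⟩
  have := pow_pos (by omega : 0 < p) s
  omega

end Parameters

/-! ### Classification -/

theorem mainTheorem1 {F : Type*} [Field F] [Fintype F] [DecidableEq F] (p : ℕ) (hp : p.Prime)
    [CharP F p] :
    -- the six families of optimal codes, with their parameters `[n, k, d; r, δ]`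
    -- (B.1)
    (∀ s τ : ℕ, 1 < s → 1 ≤ τ → τ ≤ p - 1 →
      IsOptimalWithParams (rootCode F (p ^ s) (p ^ s - p + τ))
        (p - τ) ((τ + 1) * p ^ (s - 1)) 1 (p ^ (s - 1))) ∧
    -- (B.2)
    (∀ s t : ℕ, t < s →
      IsOptimalWithParams (rootCode F (p ^ s) (p ^ s - p ^ (s - t - 1)))
        (p ^ (s - t - 1)) (p ^ (t + 1)) 1 (p ^ (t + 1))) ∧
    -- (B.3)
    (∀ τ δ : ℕ, 1 ≤ τ → τ ≤ p - 2 → 2 ≤ δ → δ ≤ τ + 1 →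
      IsOptimalWithParams (rootCode F p τ) (p - τ) (τ + 1) (p - τ) δ) ∧
    -- (B.4)
    (∀ s τ : ℕ, 1 ≤ s → 1 ≤ τ → τ ≤ p - 2 →
      IsOptimalWithParams (rootCode F (p ^ s) (τ * p ^ (s - 1)))
        ((p - τ) * p ^ (s - 1)) (τ + 1) (p - τ) (τ + 1)) ∧
    -- (B.5)
    (∀ s t : ℕ, t + 2 ≤ s →
      IsOptimalWithParams (rootCode F (p ^ s) (p ^ s - p ^ (s - t) + 1))
        (p ^ (s - t) - 1) (2 * p ^ t) 1 (p ^ t)) ∧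
    -- (B.6)
    (∀ s τ : ℕ, 1 ≤ s → 2 ≤ τ → τ ≤ p - 1 →
      IsOptimalWithParams (rootCode F (p ^ s) ((τ - 1) * p ^ (s - 1) + 1))
        ((p - τ + 1) * p ^ (s - 1) - 1) (τ + 1) (p - τ + 1) τ) ∧
    -- no other optimal codes in the analysed range, apart from the trivial cases
    (∀ s t τ i r δ : ℕ, t < s → 1 ≤ τ → τ ≤ p - 1 →
      p ^ s - p ^ (s - t) + (τ - 1) * p ^ (s - t - 1) < i →
      i ≤ p ^ s - p ^ (s - t) + τ * p ^ (s - t - 1) →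
      1 ≤ r → 2 ≤ δ →
      (i = p ^ s - p ^ (s - t) + τ * p ^ (s - t - 1) ∨ δ ≤ τ * p ^ t) →
      (IsOptimalLRC (rootCode F (p ^ s) i) r δ ↔
        InFamilies p s i r δ ∨
        (i = p ^ s - 1 ∧ δ ≤ p ^ s) ∨
        (s = 1 ∧ p - i < r ∧ δ ≤ i + 1))) ∧
    -- all families but (B.3) have unbounded length over the fixed field `F`
    (∀ N : ℕ,
      (∀ τ : ℕ, 1 ≤ τ → τ ≤ p - 1 → ∃ s : ℕ, 1 < s ∧ N < p ^ s ∧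
        IsOptimalWithParams (rootCode F (p ^ s) (p ^ s - p + τ))
          (p - τ) ((τ + 1) * p ^ (s - 1)) 1 (p ^ (s - 1))) ∧
      (∀ t : ℕ, ∃ s : ℕ, t < s ∧ N < p ^ s ∧
        IsOptimalWithParams (rootCode F (p ^ s) (p ^ s - p ^ (s - t - 1)))
          (p ^ (s - t - 1)) (p ^ (t + 1)) 1 (p ^ (t + 1))) ∧
      (∀ τ : ℕ, 1 ≤ τ → τ ≤ p - 2 → ∃ s : ℕ, 1 ≤ s ∧ N < p ^ s ∧
        IsOptimalWithParams (rootCode F (p ^ s) (τ * p ^ (s - 1)))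
          ((p - τ) * p ^ (s - 1)) (τ + 1) (p - τ) (τ + 1)) ∧
      (∀ t : ℕ, ∃ s : ℕ, t + 2 ≤ s ∧ N < p ^ s ∧
        IsOptimalWithParams (rootCode F (p ^ s) (p ^ s - p ^ (s - t) + 1))
          (p ^ (s - t) - 1) (2 * p ^ t) 1 (p ^ t)) ∧
      (∀ τ : ℕ, 2 ≤ τ → τ ≤ p - 1 → ∃ s : ℕ, 1 ≤ s ∧ N < p ^ s ∧
        IsOptimalWithParams (rootCode F (p ^ s) ((τ - 1) * p ^ (s - 1) + 1))
          ((p - τ + 1) * p ^ (s - 1) - 1) (τ + 1) (p - τ + 1) τ)) := by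

  have : Fact p.Prime := ⟨hp⟩
  have hp2 : 2 ≤ p := hp.two_le
  refine ⟨fun s τ hs h1 h2 => optimal_mds_repeated F p hs h1 h2,
    fun s t ht => optimal_full_space_repeated F p ht,
    fun τ δ h1 h2 h3 h4 => optimal_mds F p h1 (by omega) le_rfl (by omega) h4,
    fun s τ hs h1 h2 => optimal_mds_sections F p hs h1 h2,
    fun s t ht => optimal_sum_zero_repeated F p ht,
    fun s τ hs h1 h2 => optimal_mds_sections_sum_zero F p hs h1 h2, ?_, fun N => ?_⟩
  · intro s t τ i r δ ht hτ hτp hi hi' hr hδ hδ2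
    constructor
    · intro hopt
      obtain ⟨m, rfl⟩ : ∃ m, s = m + 1 + t := ⟨s - t - 1, by omega⟩
      obtain ⟨a, rfl⟩ : ∃ a, τ = a + 1 := ⟨τ - 1, by omega⟩
      simp only [Nat.add_sub_cancel] at hi hi' hδ2
      obtain ⟨j, rfl⟩ : ∃ j, i = p ^ (m + 1 + t) - p ^ (m + 1) + j :=
        ⟨i - (p ^ (m + 1 + t) - p ^ (m + 1)), by omega⟩
      have hj : a * p ^ m < j := by omega
      have hj' : j ≤ (a + 1) * p ^ m := by omega
      have hu : 0 < p ^ m := pow_pos (by omega) m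
      have hP : 0 < p ^ t := pow_pos (by omega) t
      have hjn : (a + 1) * p ^ m < p ^ (m + 1) := by
        rw [pow_succ, mul_comm]
        exact Nat.mul_lt_mul_of_pos_left (by omega) hu
      have hle : p ^ (m + 1) ≤ p ^ (m + 1 + t) := Nat.pow_le_pow_right (by omega) (by omega)
      have hup : p ^ m = 1 ∨ p ≤ p ^ m := by
        rcases Nat.eq_zero_or_pos m with rfl | hm
        · simp
        · exact Or.inr (Nat.le_self_pow (by omega) p)
      obtain ⟨k, hk⟩ : ∃ k, k + j = p ^ (m + 1) := ⟨p ^ (m + 1) - j, by omega⟩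
      have hfin : Module.finrank F
          (rootCode F (p ^ (m + 1 + t)) (p ^ (m + 1 + t) - p ^ (m + 1) + j)) = k := by
        rw [finrank_rootCode (by omega)]; omega
      have hq : (k - 1) / r * r < k := (Nat.div_mul_le_self _ _).trans_lt (by omega)
      have hq' : k ≤ ((k - 1) / r + 1) * r := by
        have := Nat.lt_div_mul_add (a := k - 1) (b := r) (by omega)
        rw [add_mul, one_mul]; omega
      obtain ⟨hloc, heq⟩ :=
        (isOptimalLRC_iff hfin (minDist_rootCode (by omega) hj hj') hq hq').1 hopt
      obtain ⟨hb1, hb2⟩ := hloc.bounds (by omega) hj'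
      have hpz : ((p ^ (m + 1) : ℕ) : ℤ) = p * (p ^ m : ℕ) := by push_cast; ring
      have hnz : ((p ^ (m + 1 + t) : ℕ) : ℤ) = p * (p ^ m : ℕ) * (p ^ t : ℕ) := by
        push_cast; ring
      have hkz : (k : ℤ) = p * (p ^ m : ℕ) - j := by rw [← hpz]; omega
      rw [hnz] at heq
      have hcases := eq_cases_of_singleton_eq (p := p) (u := (p ^ m : ℕ)) (P := (p ^ t : ℕ))
        (τ := a + 1) (j := j) (r := r) (δ := δ) (q := ((k - 1) / r : ℕ)) (k := k)
        (by exact_mod_cast hup) (by exact_mod_cast hP) (by omega) (by omega)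
        (by rw [add_sub_cancel_right]; exact_mod_cast hj) (by exact_mod_cast hj')
        (by exact_mod_cast hδ) (by exact_mod_cast hr)
        (by rw [add_assoc]; exact_mod_cast hb1)
        (hδ2.imp (fun h => by
          have : j = (a + 1) * p ^ m := by omega
          exact_mod_cast this) (fun h => by exact_mod_cast h))
        (fun h => by
          obtain ⟨h1, h2⟩ := hb2 (by exact_mod_cast h)
          exact ⟨by omega, fun h3 => by have := h2 (by exact_mod_cast h3); omega⟩)
        hkz (by positivity) (by exact_mod_cast hq) (by exact_mod_cast hq')
        (by rw [← heq]; push_cast; ring)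
      have hPt : ((p ^ t : ℕ) : ℤ) = 1 → t = 0 := fun h =>
        (Nat.pow_eq_one.1 (by exact_mod_cast h : p ^ t = 1)).resolve_left (by omega)
      have hum : ((p ^ m : ℕ) : ℤ) = 1 → m = 0 := fun h =>
        (Nat.pow_eq_one.1 (by exact_mod_cast h : p ^ m = 1)).resolve_left (by omega)
      rcases hcases with h | ⟨h1, h2, h3, h4⟩ | ⟨h1, h2, h3, h4, h5⟩ | ⟨h1, h2, h3, h4, h5⟩ |
        ⟨h1, h2, h3, h4⟩ | ⟨h1, h2, h3, h4⟩ | ⟨h1, h2, h3, h4, h5⟩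
      · refine Or.inr (Or.inl ⟨by omega, ?_⟩)
        -- here `k = 1`, and the minimum distance is at most the length
        have h1 : a + 2 ≤ p := by omega
        have h2 : p * p ^ t ≤ p ^ (m + 1 + t) := by
          rw [← pow_succ']; exact Nat.pow_le_pow_right (by omega) (by omega)
        exact hb1.trans ((Nat.mul_le_mul_right _ h1).trans h2)
      · obtain rfl := hum h1
        have ht0 : t ≠ 0 := by
          rintro rfl
          simp at h4; omega
        refine Or.inl (Or.inl ⟨by omega, a + 1, by omega, hτp, ?_, by omega, ?_⟩)
        · rw [zero_add, pow_one]; omega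
        · rw [show 0 + 1 + t - 1 = t by omega]; exact_mod_cast h4
      · have hm0 : m ≠ 0 := by
          rintro rfl
          rw [pow_zero] at h2
          omega
        refine Or.inl (Or.inr (Or.inr (Or.inr (Or.inr (Or.inl
          ⟨t, by omega, ?_, by omega, by exact_mod_cast h5⟩)))))
        rw [Nat.add_sub_cancel]; omega
      · obtain rfl := hPt h1
        obtain rfl := hum h2
        simp only [zero_add, add_zero, pow_one, Nat.sub_self] at *
        by_cases hrk : r = k
        · by_cases hp' : a + 1 ≤ p - 2
          · exact Or.inl (Or.inr (Or.inr (Or.inl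
              ⟨rfl, a + 1, by omega, hp', by omega, by omega, hδ, by omega⟩)))
          · exact Or.inr (Or.inl ⟨by omega, by omega⟩)
        · exact Or.inr (Or.inr ⟨trivial, by omega, by omega⟩)
      · have hap : a + 1 = p - 1 := by omega
        refine Or.inl (Or.inr (Or.inl ⟨t, by omega, ?_, by omega, ?_⟩))
        · rw [show m + 1 + t - t - 1 = m by omega]
          have h5 : j = (a + 1) * p ^ m := by exact_mod_cast h2
          have h6 : p ^ (m + 1) = (a + 1) * p ^ m + p ^ m := by
            rw [pow_succ, show a + 1 = p - 1 by omega, Nat.sub_mul, one_mul, mul_comm]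
            have := Nat.le_mul_of_pos_left (p ^ m) (by omega : 0 < p)
            omega
          omega
        · rw [pow_succ']; exact_mod_cast h4
      · obtain rfl := hPt h1
        have h5 : j = (a + 1) * p ^ m := by exact_mod_cast h2
        simp only [add_zero] at *
        by_cases hp' : a + 1 ≤ p - 2
        · refine Or.inl (Or.inr (Or.inr (Or.inr (Or.inl
            ⟨a + 1, by omega, hp', ?_, by omega, by omega⟩))))
          rw [Nat.add_sub_cancel]; omega
        · refine Or.inl (Or.inr (Or.inl ⟨0, by omega, ?_, by omega, ?_⟩))
          · rw [show m + 1 - 0 - 1 = m by omega]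
            have h6 : p ^ (m + 1) = (a + 1) * p ^ m + p ^ m := by
              rw [pow_succ, show a + 1 = p - 1 by omega, Nat.sub_mul, one_mul, mul_comm]
              have := Nat.le_mul_of_pos_left (p ^ m) (by omega : 0 < p)
              omega
            omega
          · rw [zero_add, pow_one]; omega
      · obtain rfl := hPt h1
        have h6 : j = a * p ^ m + 1 := by
          rw [add_sub_cancel_right] at h3
          exact_mod_cast h3
        simp only [add_zero] at *
        refine Or.inl (Or.inr (Or.inr (Or.inr (Or.inr (Or.inr
          ⟨a + 1, by omega, hτp, ?_, by omega, by omega⟩)))))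
        rw [Nat.add_sub_cancel, Nat.add_sub_cancel]; omega
    · rintro (h | ⟨rfl, h⟩ | ⟨rfl, h1, h2⟩)
      · rcases h with ⟨hs, τ', h1, h2, rfl, rfl, rfl⟩ | ⟨t', h1, rfl, rfl, rfl⟩ |
          ⟨rfl, τ', h1, h2, rfl, rfl, h3, h4⟩ | ⟨τ', h1, h2, rfl, rfl, rfl⟩ |
          ⟨t', h1, rfl, rfl, rfl⟩ | ⟨τ', h1, h2, rfl, rfl, rfl⟩
        · exact (optimal_mds_repeated F p hs h1 h2).2.2
        · exact (optimal_full_space_repeated F p h1).2.2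
        · rw [pow_one]
          exact (optimal_mds F p h1 (by omega) le_rfl (by omega) h4).2.2
        · exact (optimal_mds_sections F p (by omega) h1 h2).2.2
        · exact (optimal_sum_zero_repeated F p h1).2.2
        · exact (optimal_mds_sections_sum_zero F p (by omega) h1 h2).2.2
      · exact optimal_repetition F p hr (by omega) h (by omega)
      · obtain rfl : t = 0 := by omega
        simp only [Nat.sub_zero, Nat.sub_self, pow_one, pow_zero, mul_one, zero_add] at hi hi'
        rw [pow_one]
        exact (optimal_mds F p (by omega) (by omega) h1.le (by omega) h2).2.2
  · have hN : ∀ s, N ≤ s → N < p ^ s := fun s hs => hs.trans_lt (Nat.lt_pow_self hp.one_lt)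
    refine ⟨fun τ h1 h2 => ⟨N + 2, by omega, hN _ (by omega),
        optimal_mds_repeated F p (by omega) h1 h2⟩,
      fun t => ⟨N + t + 1, by omega, hN _ (by omega), optimal_full_space_repeated F p (by omega)⟩,
      fun τ h1 h2 => ⟨N + 1, by omega, hN _ (by omega), optimal_mds_sections F p (by omega) h1 h2⟩,
      fun t => ⟨N + t + 2, by omega, hN _ (by omega), optimal_sum_zero_repeated F p (by omega)⟩,
      fun τ h1 h2 => ⟨N + 1, by omega, hN _ (by omega),
        optimal_mds_sections_sum_zero F p (by omega) h1 h2⟩⟩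

end
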